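/- Let $\mathcal S$ be a semiring. **Propositions** (modulo $\alpha$-equivalence) are $A ::= X \mid \mathbf 1 \mid A\multimap A \mid A\otimes A \mid \top \mid \mathbf 0 \mid A\,\&\,A \mid A\oplus A \mid\, !A \mid \forall X.A$. **Proof-terms** (modulo $\alpha$-equivalence, $a\in\mathcal S$) are $$\begin{aligned} t ::={}& x \mid t+u \mid a\bullet t \mid a.\star \mid \delta_{\mathbf 1}(t,u) \mid \lambda x^A.t \mid t\,u \mid t\otimes u \mid \delta_\otimes(t,x^Ay^B.u) \mid \langle\rangle \mid \delta_{\mathbf 0}(t) \mid \langle t,u\rangle \\ &\mid \delta_\&^1(t,x^A.u) \mid \delta_\&^2(t,x^B.u) \mid \mathrm{inl}(t) \mid \mathrm{inr}(t) \mid \delta_\oplus(t,x^A.u,y^B.v) \mid\, !t \mid \delta_!(t,x^A.u) \mid \Lambda X.t \mid t\,A. \end{aligned}$$ The introductions are the proof-terms of the form $a.\star$, $\lambda x^A.t$, $t\otimes u$, $\langle\rangle$, $\langle t,u\rangle$, $\mathrm{inl}(t)$, $\mathrm{inr}(t)$, $!t$, $\Lambda X.t$. **Typing.** In $\Xi;\Gamma\vdash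 t:A$, $\Xi$ is a non-linear and $\Gamma$ a linear context; $\Gamma,\Delta$ is a disjoint union. The rules are: * $\Xi;x^A\vdash x:A$, and $\Xi,x^A;\varnothing\vdash x:A$; * if $\Xi;\Gamma\vdash t:A$ and $\Xi;\Gamma\vdash u:A$ then $\Xi;\Gamma\vdash t+u:A$; if $\Xi;\Gamma\vdash t:A$ then $\Xi;\Gamma\vdash a\bullet t:A$; * $\Xi;\varnothing\vdash a.\star:\mathbf 1$; if $\Xi;\Gamma\vdash t:\mathbf 1$ and $\Xi;\Delta\vdash u:A$ then $\Xi;\Gamma,\Delta\vdash\delta_{\mathbf 1}(t,u):A$; * if $\Xi;\Gamma,x^A\vdash t:B$ then $\Xi;\Gamma\vdash\lambda x^A.t:A\multimap B$; if $\Xi;\Gamma\vdash t:A\multimap B$ and $\Xi;\Delta\vdash u:A$ then $\Xi;\Gamma,\Delta\vdash t\,u:B$; * if $\Xi;\Gamma\vdash t:A$ and $\Xi;\Delta\vdash u:B$ then $\Xi;\Gamma,\Delta\vdash t\otimes u:A\otimes B$; if $\Xi;\Gamma\vdash t:A\otimes B$ and $\Xi;\Delta,x^A,y^B\vdash u:C$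 then $\Xi;\Gamma,\Delta\vdash\delta_\otimes(t,x^Ay^B.u):C$; * $\Xi;\Gamma\vdash\langle\rangle:\top$; if $\Xi;\Gamma\vdash t:\mathbf 0$ then $\Xi;\Gamma,\Delta\vdash\delta_{\mathbf 0}(t):C$; * if $\Xi;\Gamma\vdash t:A$ and $\Xi;\Gamma\vdash u:B$ then $\Xi;\Gamma\vdash\langle t,u\rangle:A\,\&\,B$; if $\Xi;\Gamma\vdash t:A_1\,\&\,A_2$ and $\Xi;\Delta,x^{A_i}\vdash u:C$ then $\Xi;\Gamma,\Delta\vdash\delta_\&^i(t,x^{A_i}.u):C$ ($i=1,2$); * if $\Xi;\Gamma\vdash t:A$ then $\Xi;\Gamma\vdash\mathrm{inl}(t):A\oplus B$; if $\Xi;\Gamma\vdash t:B$ then $\Xi;\Gamma\vdash\mathrm{inr}(t):A\oplus B$; if $\Xi;\Gamma\vdash t:A\oplus B$, $\Xi;\Delta,x^A\vdash u:C$ and $\Xi;\Delta,y^B\vdash v:C$ then $\Xi;\Gamma,\Delta\vdash\delta_\oplus(t,x^A.u,y^B.v):C$; * if $\Xi;\varnothing\vdash t:A$ then $\Xi;\varnothing\vdash\,!t:\,!A$;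 if $\Xi;\Gamma\vdash t:\,!A$ and $\Xi,x^A;\Delta\vdash u:B$ then $\Xi;\Gamma,\Delta\vdash\delta_!(t,x^A.u):B$; * if $\Xi;\Gamma\vdash t:A$ and $X$ is not free in $\Xi,\Gamma$ then $\Xi;\Gamma\vdash\Lambda X.t:\forall X.A$; if $\Xi;\Gamma\vdash t:\forall X.B$ then $\Xi;\Gamma\vdash t\,A:(A/X)B$. **Reduction** $\longrightarrow$ is the closure under all proof-term constructors of * $\delta_{\mathbf 1}(a.\star,t)\to a\bullet t$; $(\lambda x^A.t)\,u\to(u/x)t$; $\delta_\otimes(u\otimes v,x^Ay^B.w)\to(u/x,v/y)w$; $\delta_\&^i(\langle t_1,t_2\rangle,x^A.v)\to(t_i/x)v$; $\delta_\oplus(\mathrm{inl}(t),x^A.v,y^B.w)\to(t/x)v$; $\delta_\oplus(\mathrm{inr}(u),x^A.v,y^B.w)\to(u/y)w$; $\delta_!(!t,x^A.u)\to(t/x)u$; $(\Lambda X.t)\,A\to(A/X)t$; * $a.\star+b.\star\to(a+b).\star$; $(\lambda x^A.t)+(\lambda x^A.u)\to\lambda x^A.(t+u)$; $\langle\rangle+\langle\rangle\to\langle\rangle$;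 $\langle t,u\rangle+\langle v,w\rangle\to\langle t+v,u+w\rangle$; $!t+!u\to\,!(t+u)$; $(\Lambda X.t)+(\Lambda X.u)\to\Lambda X.(t+u)$; $\delta_\otimes(t+u,x^Ay^B.v)\to\delta_\otimes(t,x^Ay^B.v)+\delta_\otimes(u,x^Ay^B.v)$; $\delta_\oplus(t+u,x^A.v,y^B.w)\to\delta_\oplus(t,x^A.v,y^B.w)+\delta_\oplus(u,x^A.v,y^B.w)$; * $a\bullet b.\star\to(a\times b).\star$; $a\bullet\lambda x^A.t\to\lambda x^A.a\bullet t$; $a\bullet\langle\rangle\to\langle\rangle$; $a\bullet\langle t,u\rangle\to\langle a\bullet t,a\bullet u\rangle$; $a\bullet\,!t\to\,!(a\bullet t)$; $a\bullet\Lambda X.t\to\Lambda X.a\bullet t$; $\delta_\otimes(a\bullet t,x^Ay^B.v)\to a\bullet\delta_\otimes(t,x^Ay^B.v)$; $\delta_\oplus(a\bullet t,x^A.v,y^B.w)\to a\bullet\delta_\oplus(t,x^A.v,y^B.w)$. **Ultra-reduction** has in addition the rules $t+u\to t$, $t+u\to u$ and $a\bullet t\to t$. A proof-term is strongly normalising for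 a relation if no infinite reduction sequence starts from it. In the rest of the definitions $\to$ and $\to^*$ refer to ultra-reduction, and $\mathrm{SN}$ is the set of proof-terms that are strongly normalising for it. A **reducibility candidate** is a set $E$ of proof-terms with: $E\subseteq\mathrm{SN}$; if $t\in E$ and $t\to t'$ then $t'\in E$; if $t$ is not an introduction and all its one-step reducts are in $E$ then $t\in E$; if $t,u\in E$ then $t+u\in E$; if $t\in E$ and $a\in\mathcal S$ then $a\bullet t\in E$. A **valuation** $\rho$ maps each proposition variable to a candidate. Put $[\![X]\!]_\rho=\rho(X)$, $[\![\mathbf 1]\!]_\rho=[\![\top]\!]_\rho=[\![\mathbf 0]\!]_\rho=\mathrm{SN}$, and let * $[\![A\multimap B]\!]_\rho$ be the set of $t\in\mathrm{SN}$ such that $t\to^*\lambda x^C.u$ implies $(v/x)u\in[\![B]\!]_\rho$ for all $v\in[\![A]\!]_\rho$; * $[\![A\otimes B]\!]_\rho$ be the set of $t\in\mathrm{SN}$ such that $t\to^*u\otimes v$ implies $u\in[\![A]\!]_\rho$ and $v\in[\![B]\!]_\rho$; and $[\![A\,\&\,B]\!]_\rho$ likewise with $\langle u,v\rangle$; * $[\![A\oplus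 B]\!]_\rho$ be the set of $t\in\mathrm{SN}$ such that $t\to^*\mathrm{inl}(u)$ implies $u\in[\![A]\!]_\rho$, and $t\to^*\mathrm{inr}(v)$ implies $v\in[\![B]\!]_\rho$; * $[\![!A]\!]_\rho$ be the set of $t\in\mathrm{SN}$ such that $t\to^*\,!u$ implies $u\in[\![A]\!]_\rho$; * $[\![\forall X.A]\!]_\rho$ be the set of $t\in\mathrm{SN}$ such that $t\to^*\Lambda X.u$ implies $(B/X)u\in[\![A]\!]_{\rho,E/X}$ for every candidate $E$ and every proposition $B$. **Theorem.** Suppose that $\Xi;\Gamma\vdash t:A$. Then: 1. (Adequacy) for every valuation $\rho$ and every substitution $\sigma$ of proof-terms for proof-term variables such that $\sigma(x)\in[\![B]\!]_\rho$ for each $x^B\in\Xi\cup\Gamma$, we have $\sigma t\in[\![A]\!]_\rho$; 2. $t$ is strongly normalising for ultra-reduction; 3. $t$ is strongly normalising for $\longrightarrow$. -/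

import Mathlib

namespace LS2

/-- Put a value in front of a sequence indexed by de Bruijn indices. -/
def scons {α : Type*} (a : α) (f : ℕ → α) : ℕ → α
  | 0 => a
  | n + 1 => f n

/-! ### Propositions -/

/-- Propositions of second-order intuitionistic linear logic modulo `α`-equivalence: proposition
variables are de Bruijn indices and `all` binds the index `0`. -/
inductive Ty : Type
  | var (X : ℕ)
  | one
  | lolli (A B : Ty)
  | tensor (A B : Ty)
  | top
  | zero
  | wth (A B : Ty)
  | plus (A B : Ty)
  | bang (A : Ty)
  | all (A : Ty)

namespace Ty

/-- Extension of a renaming under a binder. -/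
def upRen (f : ℕ → ℕ) : ℕ → ℕ := scons 0 (fun n => f n + 1)

/-- Renaming of proposition variables in a proposition. -/
def rename : (ℕ → ℕ) → Ty → Ty
  | f, var X => var (f X)
  | _, one => one
  | f, lolli A B => lolli (A.rename f) (B.rename f)
  | f, tensor A B => tensor (A.rename f) (B.rename f)
  | _, top => top
  | _, zero => zero
  | f, wth A B => wth (A.rename f) (B.rename f)
  | f, plus A B => plus (A.rename f) (B.rename f)
  | f, bang A => bang (A.rename f)
  | f, all A => all (A.rename (upRen f))

/-- Extension of a substitution of propositions under a binder. -/
def up (θ : ℕ → Ty) : ℕ → Ty := scons (var 0) (fun n => (θ n).rename Nat.succ)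

/-- Capture-avoiding simultaneous substitution of propositions in a proposition. -/
def subst : (ℕ → Ty) → Ty → Ty
  | θ, var X => θ X
  | _, one => one
  | θ, lolli A B => lolli (A.subst θ) (B.subst θ)
  | θ, tensor A B => tensor (A.subst θ) (B.subst θ)
  | _, top => top
  | _, zero => zero
  | θ, wth A B => wth (A.subst θ) (B.subst θ)
  | θ, plus A B => plus (A.subst θ) (B.subst θ)
  | θ, bang A => bang (A.subst θ)
  | θ, all A => all (A.subst (up θ))

/-- `(B/X)A`, where `X` is the variable of index `0` (which disappears). -/
def inst (A B : Ty) : Ty := A.subst (scons B var)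

end Ty

/-! ### Proof-terms -/

/-- Proof-terms modulo `α`-equivalence, with scalars in `S`. Proof-term variables and proposition
variables are de Bruijn indices, counted separately. `tlam` binds a proposition variable. The
arguments of the other binders bind the proof-term variable `0`, except for the last argument of
`elimTensor t A B u`, which binds `x^A` as index `1` and `y^B` as index `0`. -/
inductive Tm (S : Type*) : Type _
  | var (x : ℕ)
  | sum (t u : Tm S)
  | prod (a : S) (t : Tm S)
  | star (a : S)
  | elimOne (t u : Tm S)
  | lam (A : Ty) (t : Tm S)
  | app (t u : Tm S)
  | tensor (t u : Tm S)
  | elimTensor (t : Tm S) (A B : Ty) (u : Tm S)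
  | unit
  | elimZero (t : Tm S)
  | pair (t u : Tm S)
  | elimWith1 (t : Tm S) (A : Ty) (u : Tm S)
  | elimWith2 (t : Tm S) (B : Ty) (u : Tm S)
  | inl (t : Tm S)
  | inr (t : Tm S)
  | elimPlus (t : Tm S) (A : Ty) (u : Tm S) (B : Ty) (v : Tm S)
  | bang (t : Tm S)
  | elimBang (t : Tm S) (A : Ty) (u : Tm S)
  | tlam (t : Tm S)
  | tapp (t : Tm S) (A : Ty)

namespace Tm

variable {S : Type*}

/-- Simultaneous substitution of propositions for the proposition variables of a proof-term. -/
def tySubst : (ℕ → Ty) → Tm S → Tm S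
  | _, var x => var x
  | θ, sum t u => sum (t.tySubst θ) (u.tySubst θ)
  | θ, prod a t => prod a (t.tySubst θ)
  | _, star a => star a
  | θ, elimOne t u => elimOne (t.tySubst θ) (u.tySubst θ)
  | θ, lam A t => lam (A.subst θ) (t.tySubst θ)
  | θ, app t u => app (t.tySubst θ) (u.tySubst θ)
  | θ, tensor t u => tensor (t.tySubst θ) (u.tySubst θ)
  | θ, elimTensor t A B u => elimTensor (t.tySubst θ) (A.subst θ) (B.subst θ) (u.tySubst θ)
  | _, unit => unit
  | θ, elimZero t => elimZero (t.tySubst θ)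
  | θ, pair t u => pair (t.tySubst θ) (u.tySubst θ)
  | θ, elimWith1 t A u => elimWith1 (t.tySubst θ) (A.subst θ) (u.tySubst θ)
  | θ, elimWith2 t B u => elimWith2 (t.tySubst θ) (B.subst θ) (u.tySubst θ)
  | θ, inl t => inl (t.tySubst θ)
  | θ, inr t => inr (t.tySubst θ)
  | θ, elimPlus t A u B v =>
      elimPlus (t.tySubst θ) (A.subst θ) (u.tySubst θ) (B.subst θ) (v.tySubst θ)
  | θ, bang t => bang (t.tySubst θ)
  | θ, elimBang t A u => elimBang (t.tySubst θ) (A.subst θ) (u.tySubst θ)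
  | θ, tlam t => tlam (t.tySubst (Ty.up θ))
  | θ, tapp t A => tapp (t.tySubst θ) (A.subst θ)

/-- `(B/X)t`, where `X` is the proposition variable of index `0` (which disappears). -/
def tyInst (t : Tm S) (B : Ty) : Tm S := t.tySubst (scons B Ty.var)

/-- Weakening of a proof-term by one proposition variable. -/
def tyShift (t : Tm S) : Tm S := t.tySubst (fun n => Ty.var (n + 1))

/-- Renaming of proof-term variables. -/
def rename : (ℕ → ℕ) → Tm S → Tm S
  | f, var x => var (f x)
  | f, sum t u => sum (t.rename f) (u.rename f)
  | f, prod a t => prod a (t.rename f)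
  | _, star a => star a
  | f, elimOne t u => elimOne (t.rename f) (u.rename f)
  | f, lam A t => lam A (t.rename (Ty.upRen f))
  | f, app t u => app (t.rename f) (u.rename f)
  | f, tensor t u => tensor (t.rename f) (u.rename f)
  | f, elimTensor t A B u => elimTensor (t.rename f) A B (u.rename (Ty.upRen (Ty.upRen f)))
  | _, unit => unit
  | f, elimZero t => elimZero (t.rename f)
  | f, pair t u => pair (t.rename f) (u.rename f)
  | f, elimWith1 t A u => elimWith1 (t.rename f) A (u.rename (Ty.upRen f))
  | f, elimWith2 t B u => elimWith2 (t.rename f) B (u.rename (Ty.upRen f))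
  | f, inl t => inl (t.rename f)
  | f, inr t => inr (t.rename f)
  | f, elimPlus t A u B v =>
      elimPlus (t.rename f) A (u.rename (Ty.upRen f)) B (v.rename (Ty.upRen f))
  | f, bang t => bang (t.rename f)
  | f, elimBang t A u => elimBang (t.rename f) A (u.rename (Ty.upRen f))
  | f, tlam t => tlam (t.rename f)
  | f, tapp t A => tapp (t.rename f) A

/-- Extension of a substitution under a binder of a proof-term variable. -/
def up (σ : ℕ → Tm S) : ℕ → Tm S := scons (var 0) (fun n => (σ n).rename Nat.succ)

/-- Capture-avoiding simultaneous substitution of proof-terms for proof-term variables. -/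
def subst : (ℕ → Tm S) → Tm S → Tm S
  | σ, var x => σ x
  | σ, sum t u => sum (t.subst σ) (u.subst σ)
  | σ, prod a t => prod a (t.subst σ)
  | _, star a => star a
  | σ, elimOne t u => elimOne (t.subst σ) (u.subst σ)
  | σ, lam A t => lam A (t.subst (up σ))
  | σ, app t u => app (t.subst σ) (u.subst σ)
  | σ, tensor t u => tensor (t.subst σ) (u.subst σ)
  | σ, elimTensor t A B u => elimTensor (t.subst σ) A B (u.subst (up (up σ)))
  | _, unit => unit
  | σ, elimZero t => elimZero (t.subst σ)
  | σ, pair t u => pair (t.subst σ) (u.subst σ)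
  | σ, elimWith1 t A u => elimWith1 (t.subst σ) A (u.subst (up σ))
  | σ, elimWith2 t B u => elimWith2 (t.subst σ) B (u.subst (up σ))
  | σ, inl t => inl (t.subst σ)
  | σ, inr t => inr (t.subst σ)
  | σ, elimPlus t A u B v => elimPlus (t.subst σ) A (u.subst (up σ)) B (v.subst (up σ))
  | σ, bang t => bang (t.subst σ)
  | σ, elimBang t A u => elimBang (t.subst σ) A (u.subst (up σ))
  | σ, tlam t => tlam (t.subst (fun n => (σ n).tyShift))
  | σ, tapp t A => tapp (t.subst σ) A

/-- `(u/x)t`, where `x` is the proof-term variable of index `0` (which disappears). -/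
def inst (t u : Tm S) : Tm S := t.subst (scons u var)

/-- `(u/x, v/y)t`, where `x` has index `1` and `y` has index `0` (both disappear). -/
def inst₂ (t u v : Tm S) : Tm S := t.subst (scons v (scons u var))

/-- The proof-terms that are introductions. -/
inductive IsIntro : Tm S → Prop
  | star (a : S) : IsIntro (star a)
  | lam (A : Ty) (t : Tm S) : IsIntro (lam A t)
  | tensor (t u : Tm S) : IsIntro (tensor t u)
  | unit : IsIntro unit
  | pair (t u : Tm S) : IsIntro (pair t u)
  | inl (t : Tm S) : IsIntro (inl t)
  | inr (t : Tm S) : IsIntro (inr t)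
  | bang (t : Tm S) : IsIntro (bang t)
  | tlam (t : Tm S) : IsIntro (tlam t)

end Tm

/-! ### Typing -/

/-- A context: a partial map from proof-term variables to propositions. The usual contexts are the
finite ones, with `Ξ` and `Γ` declaring distinct variables; the rules below keep this invariant, and
it is not imposed. -/
abbrev Ctx : Type := ℕ → Option Ty

namespace Ctx

/-- The empty context. -/
def empty : Ctx := fun _ => none

/-- The context `x^A`. -/
def single (x : ℕ) (A : Ty) : Ctx := fun y => if y = x then some A else none

/-- Going under the binder of a proof-term variable that is declared in this context. -/
def bind (A : Ty) (Γ : Ctx) : Ctx := scons (some A) Γ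

/-- Going under the binder of a proof-term variable that is not declared in this context
(because it is declared in the other one). -/
def skip (Γ : Ctx) : Ctx := scons none Γ

/-- Going under the binder of a proposition variable, which does not occur in the context. -/
def tyShift (Γ : Ctx) : Ctx := fun x => (Γ x).map (Ty.rename Nat.succ)

/-- `Γ` is the disjoint union `Γ₁, Γ₂`. -/
def Split (Γ Γ₁ Γ₂ : Ctx) : Prop :=
  ∀ x, (Γ₁ x = Γ x ∧ Γ₂ x = none) ∨ (Γ₁ x = none ∧ Γ₂ x = Γ x)

end Ctx

/-- `Typed Ξ Γ t A` is the sequent `Ξ; Γ ⊢ t : A`, with non-linear context `Ξ` and linear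
context `Γ`. -/
inductive Typed {S : Type*} : Ctx → Ctx → Tm S → Ty → Prop
  | linAx (Ξ : Ctx) (x : ℕ) (A : Ty) : Typed Ξ (Ctx.single x A) (.var x) A
  | ax (Ξ : Ctx) (x : ℕ) (A : Ty) : Ξ x = some A → Typed Ξ Ctx.empty (.var x) A
  | sum {Ξ Γ : Ctx} {t u : Tm S} {A : Ty} :
      Typed Ξ Γ t A → Typed Ξ Γ u A → Typed Ξ Γ (.sum t u) A
  | prod {Ξ Γ : Ctx} {t : Tm S} {A : Ty} (a : S) :
      Typed Ξ Γ t A → Typed Ξ Γ (.prod a t) A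
  | oneI (Ξ : Ctx) (a : S) : Typed Ξ Ctx.empty (.star a) .one
  | oneE {Ξ Γ Γ₁ Γ₂ : Ctx} {t u : Tm S} {A : Ty} : Ctx.Split Γ Γ₁ Γ₂ →
      Typed Ξ Γ₁ t .one → Typed Ξ Γ₂ u A → Typed Ξ Γ (.elimOne t u) A
  | lolliI {Ξ Γ : Ctx} {t : Tm S} {A B : Ty} :
      Typed Ξ.skip (Γ.bind A) t B → Typed Ξ Γ (.lam A t) (.lolli A B)
  | lolliE {Ξ Γ Γ₁ Γ₂ : Ctx} {t u : Tm S} {A B : Ty} : Ctx.Split Γ Γ₁ Γ₂ →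
      Typed Ξ Γ₁ t (.lolli A B) → Typed Ξ Γ₂ u A → Typed Ξ Γ (.app t u) B
  | tensorI {Ξ Γ Γ₁ Γ₂ : Ctx} {t u : Tm S} {A B : Ty} : Ctx.Split Γ Γ₁ Γ₂ →
      Typed Ξ Γ₁ t A → Typed Ξ Γ₂ u B → Typed Ξ Γ (.tensor t u) (.tensor A B)
  | tensorE {Ξ Γ Γ₁ Γ₂ : Ctx} {t u : Tm S} {A B C : Ty} : Ctx.Split Γ Γ₁ Γ₂ →
      Typed Ξ Γ₁ t (.tensor A B) → Typed Ξ.skip.skip ((Γ₂.bind A).bind B) u C →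
      Typed Ξ Γ (.elimTensor t A B u) C
  | topI (Ξ Γ : Ctx) : Typed Ξ Γ .unit .top
  | zeroE {Ξ Γ Γ₁ Γ₂ : Ctx} {t : Tm S} (C : Ty) : Ctx.Split Γ Γ₁ Γ₂ →
      Typed Ξ Γ₁ t .zero → Typed Ξ Γ (.elimZero t) C
  | withI {Ξ Γ : Ctx} {t u : Tm S} {A B : Ty} :
      Typed Ξ Γ t A → Typed Ξ Γ u B → Typed Ξ Γ (.pair t u) (.wth A B)
  | withE1 {Ξ Γ Γ₁ Γ₂ : Ctx} {t u : Tm S} {A B C : Ty} : Ctx.Split Γ Γ₁ Γ₂ →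
      Typed Ξ Γ₁ t (.wth A B) → Typed Ξ.skip (Γ₂.bind A) u C → Typed Ξ Γ (.elimWith1 t A u) C
  | withE2 {Ξ Γ Γ₁ Γ₂ : Ctx} {t u : Tm S} {A B C : Ty} : Ctx.Split Γ Γ₁ Γ₂ →
      Typed Ξ Γ₁ t (.wth A B) → Typed Ξ.skip (Γ₂.bind B) u C → Typed Ξ Γ (.elimWith2 t B u) C
  | plusI1 {Ξ Γ : Ctx} {t : Tm S} {A : Ty} (B : Ty) :
      Typed Ξ Γ t A → Typed Ξ Γ (.inl t) (.plus A B)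
  | plusI2 {Ξ Γ : Ctx} {t : Tm S} (A : Ty) {B : Ty} :
      Typed Ξ Γ t B → Typed Ξ Γ (.inr t) (.plus A B)
  | plusE {Ξ Γ Γ₁ Γ₂ : Ctx} {t u v : Tm S} {A B C : Ty} : Ctx.Split Γ Γ₁ Γ₂ →
      Typed Ξ Γ₁ t (.plus A B) → Typed Ξ.skip (Γ₂.bind A) u C → Typed Ξ.skip (Γ₂.bind B) v C →
      Typed Ξ Γ (.elimPlus t A u B v) C
  | bangI {Ξ : Ctx} {t : Tm S} {A : Ty} :
      Typed Ξ Ctx.empty t A → Typed Ξ Ctx.empty (.bang t) (.bang A)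
  | bangE {Ξ Γ Γ₁ Γ₂ : Ctx} {t u : Tm S} {A B : Ty} : Ctx.Split Γ Γ₁ Γ₂ →
      Typed Ξ Γ₁ t (.bang A) → Typed (Ξ.bind A) Γ₂.skip u B → Typed Ξ Γ (.elimBang t A u) B
  | allI {Ξ Γ : Ctx} {t : Tm S} {A : Ty} :
      Typed Ξ.tyShift Γ.tyShift t A → Typed Ξ Γ (.tlam t) (.all A)
  | allE {Ξ Γ : Ctx} {t : Tm S} {B : Ty} (A : Ty) :
      Typed Ξ Γ t (.all B) → Typed Ξ Γ (.tapp t A) (B.inst A)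

/-! ### Reduction -/

section Reduction

open Tm

variable {S : Type*}

/-- The twenty-five reduction rules of the calculus, at the root. -/
inductive Rule [Semiring S] : Tm S → Tm S → Prop
  | one (a : S) (t : Tm S) : Rule (elimOne (star a) t) (prod a t)
  | beta (A : Ty) (t u : Tm S) : Rule (app (lam A t) u) (t.inst u)
  | tensor (u v : Tm S) (A B : Ty) (w : Tm S) :
      Rule (elimTensor (tensor u v) A B w) (w.inst₂ u v)
  | with1 (t₁ t₂ : Tm S) (A : Ty) (v : Tm S) : Rule (elimWith1 (pair t₁ t₂) A v) (v.inst t₁)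
  | with2 (t₁ t₂ : Tm S) (A : Ty) (v : Tm S) : Rule (elimWith2 (pair t₁ t₂) A v) (v.inst t₂)
  | plus1 (t : Tm S) (A : Ty) (v : Tm S) (B : Ty) (w : Tm S) :
      Rule (elimPlus (inl t) A v B w) (v.inst t)
  | plus2 (u : Tm S) (A : Ty) (v : Tm S) (B : Ty) (w : Tm S) :
      Rule (elimPlus (inr u) A v B w) (w.inst u)
  | bang (t : Tm S) (A : Ty) (u : Tm S) : Rule (elimBang (bang t) A u) (u.inst t)
  | all (t : Tm S) (A : Ty) : Rule (tapp (tlam t) A) (t.tyInst A)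
  | sumStar (a b : S) : Rule (sum (star a) (star b)) (star (a + b))
  | sumLam (A : Ty) (t u : Tm S) : Rule (sum (lam A t) (lam A u)) (lam A (sum t u))
  | sumElimTensor (t u : Tm S) (A B : Ty) (v : Tm S) :
      Rule (elimTensor (sum t u) A B v) (sum (elimTensor t A B v) (elimTensor u A B v))
  | sumUnit : Rule (sum unit unit) unit
  | sumPair (t u v w : Tm S) : Rule (sum (pair t u) (pair v w)) (pair (sum t v) (sum u w))
  | sumElimPlus (t u : Tm S) (A : Ty) (v : Tm S) (B : Ty) (w : Tm S) :
      Rule (elimPlus (sum t u) A v B w) (sum (elimPlus t A v B w) (elimPlus u A v B w))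
  | sumBang (t u : Tm S) : Rule (sum (bang t) (bang u)) (bang (sum t u))
  | sumTlam (t u : Tm S) : Rule (sum (tlam t) (tlam u)) (tlam (sum t u))
  | prodStar (a b : S) : Rule (prod a (star b)) (star (a * b))
  | prodLam (a : S) (A : Ty) (t : Tm S) : Rule (prod a (lam A t)) (lam A (prod a t))
  | prodElimTensor (a : S) (t : Tm S) (A B : Ty) (v : Tm S) :
      Rule (elimTensor (prod a t) A B v) (prod a (elimTensor t A B v))
  | prodUnit (a : S) : Rule (prod a unit) unit
  | prodPair (a : S) (t u : Tm S) : Rule (prod a (pair t u)) (pair (prod a t) (prod a u))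
  | prodElimPlus (a : S) (t : Tm S) (A : Ty) (v : Tm S) (B : Ty) (w : Tm S) :
      Rule (elimPlus (prod a t) A v B w) (prod a (elimPlus t A v B w))
  | prodBang (a : S) (t : Tm S) : Rule (prod a (bang t)) (bang (prod a t))
  | prodTlam (a : S) (t : Tm S) : Rule (prod a (tlam t)) (tlam (prod a t))

/-- The rules of ultra-reduction, at the root. -/
inductive UltraRule [Semiring S] : Tm S → Tm S → Prop
  | base {t u : Tm S} : Rule t u → UltraRule t u
  | sumLeft (t u : Tm S) : UltraRule (sum t u) t
  | sumRight (t u : Tm S) : UltraRule (sum t u) u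
  | prod (a : S) (t : Tm S) : UltraRule (prod a t) t

/-- Closure of a relation under all proof-term constructors: one step of `R` at any position. -/
inductive Compat (R : Tm S → Tm S → Prop) : Tm S → Tm S → Prop
  | root {t t'} : R t t' → Compat R t t'
  | sum₁ {t t'} (u) : Compat R t t' → Compat R (sum t u) (sum t' u)
  | sum₂ (t) {u u'} : Compat R u u' → Compat R (sum t u) (sum t u')
  | prod (a) {t t'} : Compat R t t' → Compat R (prod a t) (prod a t')
  | elimOne₁ {t t'} (u) : Compat R t t' → Compat R (elimOne t u) (elimOne t' u)
  | elimOne₂ (t) {u u'} : Compat R u u' → Compat R (elimOne t u) (elimOne t u')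
  | lam (A) {t t'} : Compat R t t' → Compat R (lam A t) (lam A t')
  | app₁ {t t'} (u) : Compat R t t' → Compat R (app t u) (app t' u)
  | app₂ (t) {u u'} : Compat R u u' → Compat R (app t u) (app t u')
  | tensor₁ {t t'} (u) : Compat R t t' → Compat R (tensor t u) (tensor t' u)
  | tensor₂ (t) {u u'} : Compat R u u' → Compat R (tensor t u) (tensor t u')
  | elimTensor₁ {t t'} (A B u) :
      Compat R t t' → Compat R (elimTensor t A B u) (elimTensor t' A B u)
  | elimTensor₂ (t A B) {u u'} :
      Compat R u u' → Compat R (elimTensor t A B u) (elimTensor t A B u')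
  | elimZero {t t'} : Compat R t t' → Compat R (elimZero t) (elimZero t')
  | pair₁ {t t'} (u) : Compat R t t' → Compat R (pair t u) (pair t' u)
  | pair₂ (t) {u u'} : Compat R u u' → Compat R (pair t u) (pair t u')
  | elimWith1₁ {t t'} (A u) : Compat R t t' → Compat R (elimWith1 t A u) (elimWith1 t' A u)
  | elimWith1₂ (t A) {u u'} : Compat R u u' → Compat R (elimWith1 t A u) (elimWith1 t A u')
  | elimWith2₁ {t t'} (B u) : Compat R t t' → Compat R (elimWith2 t B u) (elimWith2 t' B u)
  | elimWith2₂ (t B) {u u'} : Compat R u u' → Compat R (elimWith2 t B u) (elimWith2 t B u')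
  | inl {t t'} : Compat R t t' → Compat R (inl t) (inl t')
  | inr {t t'} : Compat R t t' → Compat R (inr t) (inr t')
  | elimPlus₁ {t t'} (A u B v) :
      Compat R t t' → Compat R (elimPlus t A u B v) (elimPlus t' A u B v)
  | elimPlus₂ (t A) {u u'} (B v) :
      Compat R u u' → Compat R (elimPlus t A u B v) (elimPlus t A u' B v)
  | elimPlus₃ (t A u B) {v v'} :
      Compat R v v' → Compat R (elimPlus t A u B v) (elimPlus t A u B v')
  | bang {t t'} : Compat R t t' → Compat R (bang t) (bang t')
  | elimBang₁ {t t'} (A u) : Compat R t t' → Compat R (elimBang t A u) (elimBang t' A u)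
  | elimBang₂ (t A) {u u'} : Compat R u u' → Compat R (elimBang t A u) (elimBang t A u')
  | tlam {t t'} : Compat R t t' → Compat R (tlam t) (tlam t')
  | tapp {t t'} (A) : Compat R t t' → Compat R (tapp t A) (tapp t' A)

/-- One step of reduction. -/
def Step [Semiring S] : Tm S → Tm S → Prop := Compat Rule

/-- One step of ultra-reduction. -/
def UStep [Semiring S] : Tm S → Tm S → Prop := Compat UltraRule

/-- Many steps of ultra-reduction. -/
def USteps [Semiring S] : Tm S → Tm S → Prop := Relation.ReflTransGen UStep

/-- `t` strongly normalises for the relation `R`: there is no infinite sequence of `R`-steps that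
starts from `t`. -/
def SN (R : Tm S → Tm S → Prop) (t : Tm S) : Prop :=
  ¬ ∃ f : ℕ → Tm S, f 0 = t ∧ ∀ n, R (f n) (f (n + 1))

/-- Strong normalisation as accessibility. -/
theorem SN_iff_acc (R : Tm S → Tm S → Prop) (t : Tm S) :
    SN R t ↔ Acc (fun u v => R v u) t := by
  constructor
  · intro h
    by_contra hacc
    have key : ∀ s : {s : Tm S // ¬ Acc (fun u v => R v u) s},
        ∃ s' : {s : Tm S // ¬ Acc (fun u v => R v u) s}, R s.1 s'.1 := by
      rintro ⟨s, hs⟩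
      by_contra hno
      refine hs (Acc.intro s fun u hu => ?_)
      by_contra hu'
      exact hno ⟨⟨u, hu'⟩, hu⟩
    choose g hg using key
    exact h ⟨fun n => (g^[n] ⟨t, hacc⟩).1, rfl, fun n => by
      change R _ (g^[n + 1] _).1
      rw [Function.iterate_succ_apply']
      exact hg _⟩
  · rintro h
    induction h with
    | intro s _ ih =>
      rintro ⟨f, rfl, hf⟩
      exact ih (f 1) (hf 0) ⟨fun n => f (n + 1), rfl, fun n => hf (n + 1)⟩

/-! ### Reducibility candidates and the interpretation of propositions -/

/-- The proof-terms that are strongly normalising for ultra-reduction. -/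
def SNSet (S : Type*) [Semiring S] : Set (Tm S) := {t | SN UStep t}

/-- Reducibility candidates: sets of strongly normalising proof-terms that are closed under
reduction, under expansion of proof-terms that are not introductions, and under the interstitial
constructors `t + u` and `a • t`. -/
structure IsCandidate [Semiring S] (E : Set (Tm S)) : Prop where
  sn : E ⊆ SNSet S
  red : ∀ t t', t ∈ E → UStep t t' → t' ∈ E
  neutral : ∀ t, ¬ t.IsIntro → (∀ t', UStep t t' → t' ∈ E) → t ∈ E
  sum : ∀ t u, t ∈ E → u ∈ E → Tm.sum t u ∈ E
  prod : ∀ (a : S) (t), t ∈ E → Tm.prod a t ∈ E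

/-- The interpretation `⟦A⟧_ρ` of a proposition; `scons E ρ` is the valuation `ρ, E/X` for the
bound variable `X`, of index `0`. -/
def interp [Semiring S] : (ℕ → Set (Tm S)) → Ty → Set (Tm S)
  | ρ, .var X => ρ X
  | _, .one => SNSet S
  | _, .top => SNSet S
  | _, .zero => SNSet S
  | ρ, .lolli A B => {t | t ∈ SNSet S ∧
      ∀ C u, USteps t (lam C u) → ∀ v ∈ interp ρ A, u.inst v ∈ interp ρ B}
  | ρ, .tensor A B => {t | t ∈ SNSet S ∧
      ∀ u v, USteps t (tensor u v) → u ∈ interp ρ A ∧ v ∈ interp ρ B}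
  | ρ, .wth A B => {t | t ∈ SNSet S ∧
      ∀ u v, USteps t (pair u v) → u ∈ interp ρ A ∧ v ∈ interp ρ B}
  | ρ, .plus A B => {t | t ∈ SNSet S ∧
      (∀ u, USteps t (inl u) → u ∈ interp ρ A) ∧ (∀ v, USteps t (inr v) → v ∈ interp ρ B)}
  | ρ, .bang A => {t | t ∈ SNSet S ∧ ∀ u, USteps t (bang u) → u ∈ interp ρ A}
  | ρ, .all A => {t | t ∈ SNSet S ∧
      ∀ u, USteps t (tlam u) → ∀ E : Set (Tm S), IsCandidate E → ∀ B : Ty,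
        u.tyInst B ∈ interp (scons E ρ) A}

end Reduction

end LS2

/-!
The proof is Girard's method of reducibility candidates, carried out for ultra-reduction.

Every proposition is interpreted by a candidate (`isCandidate_interp`). All connectives are treated
at once by `isCandidate_of_values`: the interpretation of a compound proposition consists of the
strongly normalising proof-terms all of whose introduction reducts satisfy a certain property, and
this is a candidate as soon as the property is stable under reduction and under the rules pushing
`+` and `•` inside introductions. The point where strong normalisation of `t + u` does not follow
from that of `t` and `u` by induction on reductions alone is a commutation such as
`λx.t + λx.u ⟶ λx.(t + u)`, whose right-hand side contains the sum of two proper sub-terms. Since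
reducts of the body of an introduction are bodies of its reducts, reduction together with passage
to the body of an introduction is still well-founded on strongly normalising proof-terms
(`acc_subStep`), and induction along this larger relation gives `sum_mem_SNSet` and
`prod_mem_SNSet`.

Eliminations are not introductions, so they belong to a candidate once their one-step reducts do.
In `elimTensor_mem` and `elimPlus_mem` the rules that distribute the elimination over a sum or a
scalar product `t` cause no trouble, because the components of `t` are ultra-reducts of `t`, so that
the induction hypothesis on the reducts of `t` covers them.

Adequacy (`Typed.adequacy`) is an induction on the typing derivation. Proof-terms carry
propositions as annotations, and the case of `Λ` instantiates a proposition variable in them, so the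
statement is generalised to an arbitrary substitution `θ` of propositions in the proof-term, which
does not affect the interpretations. Applying adequacy to identity substitutions, which realize
every context since candidates contain all variables, yields strong normalisation for
ultra-reduction, hence for reduction, which is contained in it.
-/

namespace LS2

/-! ### The algebra of substitutions -/

namespace Ty

theorem upRen_comp (f g : ℕ → ℕ) :
    (fun n => upRen g (upRen f n)) = upRen (fun n => g (f n)) := by
  funext n; cases n <;> rfl

theorem up_upRen {f : ℕ → ℕ} {θ : ℕ → Ty} :
    (fun n => up θ (upRen f n)) = up (fun n => θ (f n)) := by
  funext n; cases n <;> rfl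

theorem rename_rename (A : Ty) (f g : ℕ → ℕ) :
    (A.rename f).rename g = A.rename (fun n => g (f n)) := by
  induction A generalizing f g <;> simp_all [rename, upRen_comp]

theorem subst_of_rename (A : Ty) (f : ℕ → ℕ) (θ : ℕ → Ty) :
    (A.rename f).subst θ = A.subst (fun n => θ (f n)) := by
  induction A generalizing f θ <;> simp_all [rename, subst, up_upRen]

theorem up_rename (θ : ℕ → Ty) (f : ℕ → ℕ) :
    (fun n => (up θ n).rename (upRen f)) = up (fun n => (θ n).rename f) := by
  funext n
  cases n with
  | zero => rfl
  | succ n => simp only [up, scons, rename_rename]; rfl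

theorem rename_of_subst (A : Ty) (θ : ℕ → Ty) (f : ℕ → ℕ) :
    (A.subst θ).rename f = A.subst (fun n => (θ n).rename f) := by
  induction A generalizing f θ <;> simp_all [rename, subst, up_rename]

theorem up_subst (θ η : ℕ → Ty) :
    (fun n => (up θ n).subst (up η)) = up (fun n => (θ n).subst η) := by
  funext n
  cases n with
  | zero => rfl
  | succ n => simp only [up, scons, subst_of_rename, rename_of_subst]

theorem subst_subst (A : Ty) (θ η : ℕ → Ty) :
    (A.subst θ).subst η = A.subst (fun n => (θ n).subst η) := by
  induction A generalizing θ η <;> simp_all [subst, up_subst]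

theorem up_var : up var = var := by
  funext n; cases n <;> rfl

theorem subst_var (A : Ty) : A.subst var = A := by
  induction A <;> simp_all [subst, up_var]

theorem rename_eq_subst (A : Ty) (f : ℕ → ℕ) : A.rename f = A.subst (fun n => var (f n)) := by
  conv_rhs => rw [← subst_of_rename A f var, subst_var]

end Ty

namespace Tm

variable {S : Type*}

theorem tySubst_tySubst (t : Tm S) (θ η : ℕ → Ty) :
    (t.tySubst θ).tySubst η = t.tySubst (fun n => (θ n).subst η) := by
  induction t generalizing θ η <;> simp_all [tySubst, Ty.subst_subst, Ty.up_subst]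

theorem tySubst_var (t : Tm S) : t.tySubst Ty.var = t := by
  induction t <;> simp_all [tySubst, Ty.subst_var, Ty.up_var]

theorem tySubst_tyShift (t : Tm S) (θ : ℕ → Ty) :
    t.tyShift.tySubst (Ty.up θ) = (t.tySubst θ).tyShift := by
  simp only [tyShift, tySubst_tySubst]
  congr 1
  funext n
  exact Ty.rename_eq_subst (θ n) Nat.succ

theorem tyInst_tyShift (t : Tm S) (B : Ty) : t.tyShift.tyInst B = t := by
  simp only [tyShift, tyInst, tySubst_tySubst]
  exact tySubst_var t

theorem tyInst_tySubst_up (t : Tm S) (θ : ℕ → Ty) (B : Ty) :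
    (t.tySubst (Ty.up θ)).tyInst B = t.tySubst (scons B θ) := by
  simp only [tyInst, tySubst_tySubst]
  congr 1
  funext n
  cases n with
  | zero => rfl
  | succ n => exact (Ty.subst_of_rename _ _ _).trans (Ty.subst_var _)

theorem tyInst_tySubst (t : Tm S) (θ : ℕ → Ty) (B : Ty) :
    (t.tyInst B).tySubst θ = (t.tySubst (Ty.up θ)).tyInst (B.subst θ) := by
  rw [tyInst_tySubst_up, tyInst, tySubst_tySubst]
  congr 1
  funext n
  cases n <;> rfl

theorem rename_rename (t : Tm S) (f g : ℕ → ℕ) :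
    (t.rename f).rename g = t.rename (fun n => g (f n)) := by
  induction t generalizing f g <;> simp_all [rename, Ty.upRen_comp]

theorem tySubst_rename (t : Tm S) (f : ℕ → ℕ) (θ : ℕ → Ty) :
    (t.rename f).tySubst θ = (t.tySubst θ).rename f := by
  induction t generalizing f θ <;> simp_all [rename, tySubst]

theorem up_upRen (f : ℕ → ℕ) (σ : ℕ → Tm S) :
    (fun n => up σ (Ty.upRen f n)) = up (fun n => σ (f n)) := by
  funext n; cases n <;> rfl

theorem subst_of_rename (t : Tm S) (f : ℕ → ℕ) (σ : ℕ → Tm S) :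
    (t.rename f).subst σ = t.subst (fun n => σ (f n)) := by
  induction t generalizing f σ <;> simp_all [rename, subst, up_upRen]

theorem up_rename (σ : ℕ → Tm S) (f : ℕ → ℕ) :
    (fun n => (up σ n).rename (Ty.upRen f)) = up (fun n => (σ n).rename f) := by
  funext n
  cases n with
  | zero => rfl
  | succ n => simp only [up, scons, rename_rename]; rfl

theorem rename_of_subst (t : Tm S) (σ : ℕ → Tm S) (f : ℕ → ℕ) :
    (t.subst σ).rename f = t.subst (fun n => (σ n).rename f) := by
  induction t generalizing f σ <;> simp_all [rename, subst, up_rename, tyShift, tySubst_rename]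

theorem up_tySubst (σ : ℕ → Tm S) (θ : ℕ → Ty) :
    (fun n => (up σ n).tySubst θ) = up (fun n => (σ n).tySubst θ) := by
  funext n
  cases n with
  | zero => rfl
  | succ n => simp only [up, scons, tySubst_rename]

theorem tySubst_subst (t : Tm S) (σ : ℕ → Tm S) (θ : ℕ → Ty) :
    (t.subst σ).tySubst θ = (t.tySubst θ).subst (fun n => (σ n).tySubst θ) := by
  induction t generalizing σ θ <;> simp_all [tySubst, subst, up_tySubst, tySubst_tyShift]

theorem up_subst (σ τ : ℕ → Tm S) :
    (fun n => (up σ n).subst (up τ)) = up (fun n => (σ n).subst τ) := by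
  funext n
  cases n with
  | zero => rfl
  | succ n => simp only [up, scons, subst_of_rename, rename_of_subst]

theorem subst_tyShift (t : Tm S) (σ : ℕ → Tm S) :
    t.tyShift.subst (fun n => (σ n).tyShift) = (t.subst σ).tyShift :=
  (tySubst_subst _ _ _).symm

theorem subst_subst (t : Tm S) (σ τ : ℕ → Tm S) :
    (t.subst σ).subst τ = t.subst (fun n => (σ n).subst τ) := by
  induction t generalizing σ τ <;> simp_all [subst, up_subst, subst_tyShift]

theorem up_var : up (var : ℕ → Tm S) = var := by
  funext n; cases n <;> rfl

theorem subst_var (t : Tm S) : t.subst var = t := by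
  induction t <;> simp_all [subst, up_var, tyShift, tySubst]

theorem inst_subst_up (t : Tm S) (σ : ℕ → Tm S) (v : Tm S) :
    (t.subst (up σ)).inst v = t.subst (scons v σ) := by
  rw [inst, subst_subst]
  congr 1
  funext n
  cases n with
  | zero => rfl
  | succ n => exact (subst_of_rename _ _ _).trans (subst_var _)

theorem inst₂_subst_up (t : Tm S) (σ : ℕ → Tm S) (u v : Tm S) :
    (t.subst (up (up σ))).inst₂ u v = t.subst (scons v (scons u σ)) := by
  rw [inst₂, subst_subst]
  congr 1
  funext n
  rcases n with _ | _ | n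
  · rfl
  · rfl
  · exact (subst_of_rename _ _ _).trans ((subst_of_rename _ _ _).trans (subst_var _))

theorem inst_subst (t u : Tm S) (σ : ℕ → Tm S) :
    (t.inst u).subst σ = (t.subst (up σ)).inst (u.subst σ) := by
  rw [inst_subst_up, inst, subst_subst]
  congr 1
  funext n
  cases n <;> rfl

theorem inst₂_subst (t u v : Tm S) (σ : ℕ → Tm S) :
    (t.inst₂ u v).subst σ = (t.subst (up (up σ))).inst₂ (u.subst σ) (v.subst σ) := by
  rw [inst₂_subst_up, inst₂, subst_subst]
  congr 1
  funext n
  rcases n with _ | _ | n <;> rfl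

theorem inst_tySubst (t u : Tm S) (θ : ℕ → Ty) :
    (t.inst u).tySubst θ = (t.tySubst θ).inst (u.tySubst θ) := by
  rw [inst, inst, tySubst_subst]
  congr 1
  funext n
  cases n <;> rfl

theorem inst₂_tySubst (t u v : Tm S) (θ : ℕ → Ty) :
    (t.inst₂ u v).tySubst θ = (t.tySubst θ).inst₂ (u.tySubst θ) (v.tySubst θ) := by
  rw [inst₂, inst₂, tySubst_subst]
  congr 1
  funext n
  rcases n with _ | _ | n <;> rfl

theorem tyInst_subst (t : Tm S) (σ : ℕ → Tm S) (B : Ty) :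
    (t.subst (fun n => (σ n).tyShift)).tyInst B = (t.tyInst B).subst σ := by
  rw [tyInst, tySubst_subst]
  congr 1
  funext n
  exact tyInst_tyShift (σ n) B

end Tm

/-! ### Compatible closure and stability of reduction under substitution -/

section Reduction

variable {S : Type*}

theorem Compat.subst {R : Tm S → Tm S → Prop}
    (hR : ∀ t t' (σ : ℕ → Tm S), R t t' → R (t.subst σ) (t'.subst σ))
    {t t' : Tm S} (h : Compat R t t') (σ : ℕ → Tm S) : Compat R (t.subst σ) (t'.subst σ) := by
  induction h generalizing σ with
  | root h => exact .root (hR _ _ σ h)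
  | _ => grind [Compat, Tm.subst]

theorem Compat.tySubst {R : Tm S → Tm S → Prop}
    (hR : ∀ t t' (θ : ℕ → Ty), R t t' → R (t.tySubst θ) (t'.tySubst θ))
    {t t' : Tm S} (h : Compat R t t') (θ : ℕ → Ty) : Compat R (t.tySubst θ) (t'.tySubst θ) := by
  induction h generalizing θ with
  | root h => exact .root (hR _ _ θ h)
  | _ => grind [Compat, Tm.tySubst]

theorem Compat.mono {R R' : Tm S → Tm S → Prop} (hR : ∀ t t', R t t' → R' t t') {t t' : Tm S}
    (h : Compat R t t') : Compat R' t t' := by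
  induction h with
  | root h => exact .root (hR _ _ h)
  | _ => grind [Compat]

variable [Semiring S]

theorem Rule.subst {t t' : Tm S} (h : Rule t t') (σ : ℕ → Tm S) :
    Rule (t.subst σ) (t'.subst σ) := by
  cases h <;>
    simp only [Tm.subst, Tm.inst_subst, Tm.inst₂_subst, ← Tm.tyInst_subst] <;> constructor

theorem Rule.tySubst {t t' : Tm S} (h : Rule t t') (θ : ℕ → Ty) :
    Rule (t.tySubst θ) (t'.tySubst θ) := by
  cases h <;>
    simp only [Tm.tySubst, Tm.inst_tySubst, Tm.inst₂_tySubst, Tm.tyInst_tySubst] <;> constructor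

theorem UltraRule.subst {t t' : Tm S} (h : UltraRule t t') (σ : ℕ → Tm S) :
    UltraRule (t.subst σ) (t'.subst σ) := by
  cases h with
  | base h => exact .base (h.subst σ)
  | sumLeft => exact .sumLeft _ _
  | sumRight => exact .sumRight _ _
  | prod => exact .prod _ _

theorem UltraRule.tySubst {t t' : Tm S} (h : UltraRule t t') (θ : ℕ → Ty) :
    UltraRule (t.tySubst θ) (t'.tySubst θ) := by
  cases h with
  | base h => exact .base (h.tySubst θ)
  | sumLeft => exact .sumLeft _ _
  | sumRight => exact .sumRight _ _
  | prod => exact .prod _ _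

theorem UStep.subst {t t' : Tm S} (h : UStep t t') (σ : ℕ → Tm S) :
    UStep (t.subst σ) (t'.subst σ) :=
  Compat.subst (fun _ _ σ h => h.subst σ) h σ

theorem UStep.tySubst {t t' : Tm S} (h : UStep t t') (θ : ℕ → Ty) :
    UStep (t.tySubst θ) (t'.tySubst θ) :=
  Compat.tySubst (fun _ _ θ h => h.tySubst θ) h θ

theorem USteps.subst {t t' : Tm S} (h : USteps t t') (σ : ℕ → Tm S) :
    USteps (t.subst σ) (t'.subst σ) :=
  Relation.ReflTransGen.lift _ (fun _ _ h => UStep.subst h σ) _ _ h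

theorem USteps.tySubst {t t' : Tm S} (h : USteps t t') (θ : ℕ → Ty) :
    USteps (t.tySubst θ) (t'.tySubst θ) :=
  Relation.ReflTransGen.lift _ (fun _ _ h => UStep.tySubst h θ) _ _ h

end Reduction

end LS2

namespace LS2

section Reduction

open Tm

variable {S : Type*} [Semiring S]

/-! ### Strong normalisation -/

theorem mem_SNSet {t : Tm S} : t ∈ SNSet S ↔ Acc (fun u v => UStep v u) t :=
  SN_iff_acc _ _

theorem mem_SNSet_of_forall {t : Tm S} (h : ∀ t', UStep t t' → t' ∈ SNSet S) : t ∈ SNSet S :=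
  mem_SNSet.2 (Acc.intro _ fun t' ht' => mem_SNSet.1 (h t' ht'))

theorem UStep.mem_SNSet {t t' : Tm S} (h : UStep t t') (ht : t ∈ SNSet S) : t' ∈ SNSet S :=
  LS2.mem_SNSet.2 ((LS2.mem_SNSet.1 ht).inv h)

/-- Well-founded induction along ultra-reduction. -/
@[elab_as_elim]
theorem SNSet_induction {p : (t : Tm S) → t ∈ SNSet S → Prop}
    (step : ∀ (t : Tm S) (ht : t ∈ SNSet S),
      (∀ (t' : Tm S) (h : UStep t t'), p t' (h.mem_SNSet ht)) → p t ht)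
    (t : Tm S) (ht : t ∈ SNSet S) : p t ht := by
  induction mem_SNSet.1 ht with
  | intro t _ ih => exact step t ht fun t' h => ih t' h (h.mem_SNSet ht)

theorem mem_SNSet_of_map {F : Tm S → Tm S} (hF : ∀ t t', UStep t t' → UStep (F t) (F t'))
    {t : Tm S} (h : F t ∈ SNSet S) : t ∈ SNSet S :=
  mem_SNSet.2 <| Subrelation.accessible (fun {_ _} h => hF _ _ h)
    (InvImage.accessible F (mem_SNSet.1 h))

theorem mem_SNSet_of_subst {t : Tm S} {σ : ℕ → Tm S} (h : t.subst σ ∈ SNSet S) : t ∈ SNSet S :=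
  mem_SNSet_of_map (F := fun t => t.subst σ) (fun _ _ h => h.subst σ) h

theorem mem_SNSet_of_tySubst {t : Tm S} {θ : ℕ → Ty} (h : t.tySubst θ ∈ SNSet S) :
    t ∈ SNSet S :=
  mem_SNSet_of_map (F := fun t => t.tySubst θ) (fun _ _ h => h.tySubst θ) h

/-! ### Reduction of introductions -/

theorem UStep.star_inv {a : S} {s : Tm S} (h : UStep (star a) s) : False := by
  rcases h with ⟨⟨⟨⟩⟩⟩

theorem UStep.unit_inv {s : Tm S} (h : UStep (unit : Tm S) s) : False := by
  rcases h with ⟨⟨⟨⟩⟩⟩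

theorem UStep.lam_inv {A : Ty} {t s : Tm S} (h : UStep (lam A t) s) :
    ∃ t', UStep t t' ∧ s = lam A t' := by
  rcases h with ⟨⟨⟨⟩⟩⟩
  exact ⟨_, ‹_›, rfl⟩

theorem UStep.tensor_inv {t u s : Tm S} (h : UStep (tensor t u) s) :
    (∃ t', UStep t t' ∧ s = tensor t' u) ∨ ∃ u', UStep u u' ∧ s = tensor t u' := by
  rcases h with ⟨⟨⟨⟩⟩⟩
  · exact .inl ⟨_, ‹_›, rfl⟩
  · exact .inr ⟨_, ‹_›, rfl⟩

theorem UStep.pair_inv {t u s : Tm S} (h : UStep (pair t u) s) :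
    (∃ t', UStep t t' ∧ s = pair t' u) ∨ ∃ u', UStep u u' ∧ s = pair t u' := by
  rcases h with ⟨⟨⟨⟩⟩⟩
  · exact .inl ⟨_, ‹_›, rfl⟩
  · exact .inr ⟨_, ‹_›, rfl⟩

theorem UStep.inl_inv {t s : Tm S} (h : UStep (inl t) s) : ∃ t', UStep t t' ∧ s = inl t' := by
  rcases h with ⟨⟨⟨⟩⟩⟩
  exact ⟨_, ‹_›, rfl⟩

theorem UStep.inr_inv {t s : Tm S} (h : UStep (inr t) s) : ∃ t', UStep t t' ∧ s = inr t' := by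
  rcases h with ⟨⟨⟨⟩⟩⟩
  exact ⟨_, ‹_›, rfl⟩

theorem UStep.bang_inv {t s : Tm S} (h : UStep (bang t) s) : ∃ t', UStep t t' ∧ s = bang t' := by
  rcases h with ⟨⟨⟨⟩⟩⟩
  exact ⟨_, ‹_›, rfl⟩

theorem UStep.tlam_inv {t s : Tm S} (h : UStep (tlam t) s) : ∃ t', UStep t t' ∧ s = tlam t' := by
  rcases h with ⟨⟨⟨⟩⟩⟩
  exact ⟨_, ‹_›, rfl⟩

theorem UStep.isIntro {s s' : Tm S} (h : UStep s s') (hs : s.IsIntro) : s'.IsIntro := by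
  cases hs with
  | star => exact h.star_inv.elim
  | unit => exact h.unit_inv.elim
  | lam => obtain ⟨_, _, rfl⟩ := h.lam_inv; constructor
  | tensor => obtain ⟨_, _, rfl⟩ | ⟨_, _, rfl⟩ := h.tensor_inv <;> constructor
  | pair => obtain ⟨_, _, rfl⟩ | ⟨_, _, rfl⟩ := h.pair_inv <;> constructor
  | inl => obtain ⟨_, _, rfl⟩ := h.inl_inv; constructor
  | inr => obtain ⟨_, _, rfl⟩ := h.inr_inv; constructor
  | bang => obtain ⟨_, _, rfl⟩ := h.bang_inv; constructor
  | tlam => obtain ⟨_, _, rfl⟩ := h.tlam_inv; constructor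

section Congruence

/-! The next lemmas concern a constructor `F` all of whose reductions take place in an argument. -/

variable {F : Tm S → Tm S} {G : Tm S → Tm S → Tm S}

theorem mem_SNSet_of_inv (hF : ∀ t s, UStep (F t) s → ∃ t', UStep t t' ∧ s = F t')
    {t : Tm S} (ht : t ∈ SNSet S) : F t ∈ SNSet S := by
  induction t, ht using SNSet_induction with | step t _ ih
  refine mem_SNSet_of_forall fun s hs => ?_
  obtain ⟨t', h, rfl⟩ := hF t s hs
  exact ih t' h

theorem mem_SNSet_of_inv₂
    (hG : ∀ t u s, UStep (G t u) s →
      (∃ t', UStep t t' ∧ s = G t' u) ∨ ∃ u', UStep u u' ∧ s = G t u')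
    {t u : Tm S} (ht : t ∈ SNSet S) (hu : u ∈ SNSet S) : G t u ∈ SNSet S := by
  induction t, ht using SNSet_induction generalizing u with | step t _ iht
  induction u, hu using SNSet_induction with | step u hu ihu
  refine mem_SNSet_of_forall fun s hs => ?_
  obtain ⟨t', h, rfl⟩ | ⟨u', h, rfl⟩ := hG t u s hs
  · exact iht t' h hu
  · exact ihu u' h

theorem USteps.of_inv (hF : ∀ t s, UStep (F t) s → ∃ t', UStep t t' ∧ s = F t')
    {t s : Tm S} (h : USteps (F t) s) : ∃ t', USteps t t' ∧ s = F t' := by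
  induction h with
  | refl => exact ⟨t, .refl, rfl⟩
  | tail _ h ih =>
    obtain ⟨t', h', rfl⟩ := ih
    obtain ⟨t'', h'', rfl⟩ := hF _ _ h
    exact ⟨t'', h'.tail h'', rfl⟩

theorem USteps.of_inv₂
    (hG : ∀ t u s, UStep (G t u) s →
      (∃ t', UStep t t' ∧ s = G t' u) ∨ ∃ u', UStep u u' ∧ s = G t u')
    {t u s : Tm S} (h : USteps (G t u) s) :
    ∃ t' u', USteps t t' ∧ USteps u u' ∧ s = G t' u' := by
  induction h with
  | refl => exact ⟨t, u, .refl, .refl, rfl⟩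
  | tail _ h ih =>
    obtain ⟨t', u', h₁, h₂, rfl⟩ := ih
    obtain ⟨t'', h'', rfl⟩ | ⟨u'', h'', rfl⟩ := hG _ _ _ h
    · exact ⟨t'', u', h₁.tail h'', h₂, rfl⟩
    · exact ⟨t', u'', h₁, h₂.tail h'', rfl⟩

end Congruence

/-! ### Strong normalisation of sums and scalar products -/

/-- `IntroArg t s`: the proof-term `t` is one of the introductions which commute with sums and
scalar products, and `s` is one of its immediate sub-terms. -/
inductive IntroArg : Tm S → Tm S → Prop
  | lam (A : Ty) (t : Tm S) : IntroArg (lam A t) t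
  | pair₁ (t u : Tm S) : IntroArg (pair t u) t
  | pair₂ (t u : Tm S) : IntroArg (pair t u) u
  | bang (t : Tm S) : IntroArg (bang t) t
  | tlam (t : Tm S) : IntroArg (tlam t) t

/-- A step from a proof-term to a reduct, or to the body of an introduction. -/
def SubStep (t s : Tm S) : Prop := UStep t s ∨ IntroArg t s

theorem acc_subStep_of_forall (t : Tm S)
    (h : ∀ t', UStep t t' → Acc (fun u v => SubStep v u) t') : Acc (fun u v => SubStep v u) t := by
  -- A reduct `s'` of the body of `t` is the body of a reduct of `t`.
  induction t with
  | lam A t ih =>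
    refine .intro _ fun s hs => hs.elim (h s) ?_
    rintro ⟨⟩
    exact ih fun s' hs' => (h _ (.lam A hs')).inv (.inr (.lam _ _))
  | pair t u iht ihu =>
    refine .intro _ fun s hs => hs.elim (h s) ?_
    rintro (_ | _ | _)
    · exact iht fun s' hs' => (h _ (.pair₁ u hs')).inv (.inr (.pair₁ _ _))
    · exact ihu fun s' hs' => (h _ (.pair₂ t hs')).inv (.inr (.pair₂ _ _))
  | bang t ih =>
    refine .intro _ fun s hs => hs.elim (h s) ?_
    rintro ⟨⟩
    exact ih fun s' hs' => (h _ (.bang hs')).inv (.inr (.bang _))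
  | tlam t ih =>
    refine .intro _ fun s hs => hs.elim (h s) ?_
    rintro ⟨⟩
    exact ih fun s' hs' => (h _ (.tlam hs')).inv (.inr (.tlam _))
  | _ => exact .intro _ fun s hs => hs.elim (h s) (by rintro ⟨⟩)

/-- On strongly normalising proof-terms one may argue by induction along reduction and passage to
the body of an introduction together. This is what the commutation rules such as
`λx.t + λx.u ⟶ λx.(t + u)` require. -/
theorem acc_subStep {t : Tm S} (ht : t ∈ SNSet S) : Acc (fun u v => SubStep v u) t := by
  induction t, ht using SNSet_induction with | step t _ ih
  exact acc_subStep_of_forall t ih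

theorem star_mem_SNSet (a : S) : star a ∈ SNSet S :=
  mem_SNSet_of_forall fun _ h => h.star_inv.elim

theorem unit_mem_SNSet : (unit : Tm S) ∈ SNSet S :=
  mem_SNSet_of_forall fun _ h => h.unit_inv.elim

theorem sum_mem_SNSet {t u : Tm S} (ht : t ∈ SNSet S) (hu : u ∈ SNSet S) :
    sum t u ∈ SNSet S := by
  have key := acc_subStep ht
  induction key generalizing u with
  | intro t _ iht =>
  have key := acc_subStep hu
  induction key with
  | intro u _ ihu =>
  refine mem_SNSet_of_forall fun s hs => ?_
  rcases hs with h | ⟨_, h⟩ | ⟨_, h⟩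
  · cases h with
    | base h =>
      cases h with
      | sumStar => exact star_mem_SNSet _
      | sumUnit => exact unit_mem_SNSet
      | sumLam A t u =>
        exact mem_SNSet_of_inv (fun _ _ => UStep.lam_inv)
          (iht _ (.inr (.lam _ _)) (mem_SNSet_of_map (fun _ _ => .lam A) ht)
            (mem_SNSet_of_map (fun _ _ => .lam A) hu))
      | sumPair t u v w =>
        exact mem_SNSet_of_inv₂ (fun _ _ _ => UStep.pair_inv)
          (iht _ (.inr (.pair₁ _ _))
            (mem_SNSet_of_map (F := fun t => pair t u) (fun _ _ => .pair₁ u) ht)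
            (mem_SNSet_of_map (F := fun t => pair t w) (fun _ _ => .pair₁ w) hu))
          (iht _ (.inr (.pair₂ _ _)) (mem_SNSet_of_map (fun _ _ => .pair₂ t) ht)
            (mem_SNSet_of_map (fun _ _ => .pair₂ v) hu))
      | sumBang t u =>
        exact mem_SNSet_of_inv (fun _ _ => UStep.bang_inv)
          (iht _ (.inr (.bang _)) (mem_SNSet_of_map (fun _ _ => .bang) ht)
            (mem_SNSet_of_map (fun _ _ => .bang) hu))
      | sumTlam t u =>
        exact mem_SNSet_of_inv (fun _ _ => UStep.tlam_inv)
          (iht _ (.inr (.tlam _)) (mem_SNSet_of_map (fun _ _ => .tlam) ht)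
            (mem_SNSet_of_map (fun _ _ => .tlam) hu))
    | sumLeft => exact ht
    | sumRight => exact hu
  · exact iht _ (.inl h) (UStep.mem_SNSet h ht) hu
  · exact ihu _ (.inl h) (UStep.mem_SNSet h hu)

theorem prod_mem_SNSet (a : S) {t : Tm S} (ht : t ∈ SNSet S) : prod a t ∈ SNSet S := by
  have key := acc_subStep ht
  induction key with
  | intro t _ ih =>
  refine mem_SNSet_of_forall fun s hs => ?_
  rcases hs with h | _ | _ | ⟨_, h⟩
  · cases h with
    | base h =>
      cases h with
      | prodStar => exact star_mem_SNSet _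
      | prodUnit => exact unit_mem_SNSet
      | prodLam _ A t =>
        exact mem_SNSet_of_inv (fun _ _ => UStep.lam_inv)
          (ih _ (.inr (.lam _ _)) (mem_SNSet_of_map (fun _ _ => .lam A) ht))
      | prodPair _ t u =>
        exact mem_SNSet_of_inv₂ (fun _ _ _ => UStep.pair_inv)
          (ih _ (.inr (.pair₁ _ _))
            (mem_SNSet_of_map (F := fun t => pair t u) (fun _ _ => .pair₁ u) ht))
          (ih _ (.inr (.pair₂ _ _)) (mem_SNSet_of_map (fun _ _ => .pair₂ t) ht))
      | prodBang _ t =>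
        exact mem_SNSet_of_inv (fun _ _ => UStep.bang_inv)
          (ih _ (.inr (.bang _)) (mem_SNSet_of_map (fun _ _ => .bang) ht))
      | prodTlam _ t =>
        exact mem_SNSet_of_inv (fun _ _ => UStep.tlam_inv)
          (ih _ (.inr (.tlam _)) (mem_SNSet_of_map (fun _ _ => .tlam) ht))
    | prod => exact ht
  · exact ih _ (.inl h) (UStep.mem_SNSet h ht)

/-! ### Candidates determined by their introductions -/

theorem USteps.isIntro {s s' : Tm S} (h : USteps s s') (hs : s.IsIntro) : s'.IsIntro := by
  induction h with
  | refl => exact hs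
  | tail _ h ih => exact h.isIntro ih

theorem Rule.isIntro_of_sum {t u r : Tm S} (h : Rule (sum t u) r) :
    t.IsIntro ∧ u.IsIntro ∧ r.IsIntro := by
  cases h <;> exact ⟨by constructor, by constructor, by constructor⟩

theorem Rule.isIntro_of_prod {a : S} {t r : Tm S} (h : Rule (prod a t) r) :
    t.IsIntro ∧ r.IsIntro := by
  cases h <;> exact ⟨by constructor, by constructor⟩

theorem USteps.sum_inv {t u s : Tm S} (h : USteps (sum t u) s) (hs : s.IsIntro) :
    USteps t s ∨ USteps u s ∨
      ∃ t' u' r, USteps t t' ∧ USteps u u' ∧ Rule (sum t' u') r ∧ USteps r s := by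
  generalize hw : sum t u = w at h
  induction h using Relation.ReflTransGen.head_induction_on generalizing t u with
  | refl => subst hw; cases hs
  | head h hsteps ih =>
    subst hw
    rcases h with h | ⟨_, h⟩ | ⟨_, h⟩
    · cases h with
      | base h => exact .inr (.inr ⟨t, u, _, .refl, .refl, h, hsteps⟩)
      | sumLeft => exact .inl hsteps
      | sumRight => exact .inr (.inl hsteps)
    · obtain h' | h' | ⟨t', u', r, h₁, h₂, h₃, h₄⟩ := ih rfl
      · exact .inl (.head h h')
      · exact .inr (.inl h')
      · exact .inr (.inr ⟨t', u', r, .head h h₁, h₂, h₃, h₄⟩)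
    · obtain h' | h' | ⟨t', u', r, h₁, h₂, h₃, h₄⟩ := ih rfl
      · exact .inl h'
      · exact .inr (.inl (.head h h'))
      · exact .inr (.inr ⟨t', u', r, h₁, .head h h₂, h₃, h₄⟩)

theorem USteps.prod_inv {a : S} {t s : Tm S} (h : USteps (prod a t) s) (hs : s.IsIntro) :
    USteps t s ∨ ∃ t' r, USteps t t' ∧ Rule (prod a t') r ∧ USteps r s := by
  generalize hw : prod a t = w at h
  induction h using Relation.ReflTransGen.head_induction_on generalizing t with
  | refl => subst hw; cases hs
  | head h hsteps ih =>
    subst hw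
    rcases h with h | _ | _ | ⟨_, h⟩
    · cases h with
      | base h => exact .inr ⟨t, _, .refl, h, hsteps⟩
      | prod => exact .inl hsteps
    · obtain h' | ⟨t', r, h₁, h₃, h₄⟩ := ih rfl
      · exact .inl (.head h h')
      · exact .inr ⟨t', r, .head h h₁, h₃, h₄⟩

/-- If a property `P` of introductions is stable under reduction and under the rules that push
sums and scalar products inside introductions, then the strongly normalising proof-terms all of
whose introduction reducts satisfy `P` form a candidate. The interpretation of every
compound proposition has this shape. -/
theorem isCandidate_of_values {P : Tm S → Prop}
    (hstep : ∀ s s', s.IsIntro → P s → UStep s s' → P s')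
    (hsum : ∀ s s' r, P s → P s' → Rule (sum s s') r → P r)
    (hprod : ∀ a s r, P s → Rule (prod a s) r → P r) :
    IsCandidate {t : Tm S | t ∈ SNSet S ∧ ∀ s, s.IsIntro → USteps t s → P s} := by
  have hsteps : ∀ s s', s.IsIntro → P s → USteps s s' → P s' := by
    intro s s' hs hP h
    induction h with
    | refl => exact hP
    | tail h₁ h₂ ih => exact hstep _ _ (USteps.isIntro h₁ hs) ih h₂
  refine ⟨fun t ht => ht.1, ?_, ?_, ?_, ?_⟩
  · exact fun t t' ht h => ⟨h.mem_SNSet ht.1, fun s hs h' => ht.2 s hs (.head h h')⟩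
  · refine fun t ht h => ⟨mem_SNSet_of_forall fun t' h' => (h t' h').1, fun s hs h' => ?_⟩
    obtain rfl | ⟨t', h₁, h₂⟩ := Relation.ReflTransGen.cases_head h'
    · exact (ht hs).elim
    · exact (h t' h₁).2 s hs h₂
  · refine fun t u ht hu => ⟨sum_mem_SNSet ht.1 hu.1, fun s hs h => ?_⟩
    obtain h | h | ⟨t', u', r, h₁, h₂, h₃, h₄⟩ := h.sum_inv hs
    · exact ht.2 s hs h
    · exact hu.2 s hs h
    · obtain ⟨i₁, i₂, i₃⟩ := h₃.isIntro_of_sum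
      exact hsteps r s i₃ (hsum t' u' r (ht.2 t' i₁ h₁) (hu.2 u' i₂ h₂) h₃) h₄
  · refine fun a t ht => ⟨prod_mem_SNSet a ht.1, fun s hs h => ?_⟩
    obtain h | ⟨t', r, h₁, h₃, h₄⟩ := h.prod_inv hs
    · exact ht.2 s hs h
    · obtain ⟨i₁, i₃⟩ := h₃.isIntro_of_prod
      exact hsteps r s i₃ (hprod a t' r (ht.2 t' i₁ h₁) h₃) h₄

theorem isCandidate_SNSet : IsCandidate (SNSet S) where
  sn := subset_rfl
  red _ _ ht h := h.mem_SNSet ht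
  neutral _ _ h := mem_SNSet_of_forall h
  sum _ _ := sum_mem_SNSet
  prod a _ := prod_mem_SNSet a

theorem IsCandidate.var_mem {E : Set (Tm S)} (hE : IsCandidate E) (x : ℕ) : var x ∈ E :=
  hE.neutral _ (by rintro ⟨⟩) (by rintro _ ⟨⟨⟨⟩⟩⟩)

theorem IsCandidate.mem_SNSet_of_inst {E F : Set (Tm S)} (hE : IsCandidate E)
    (hF : IsCandidate F) {u : Tm S} (hu : ∀ v ∈ E, u.inst v ∈ F) : u ∈ SNSet S :=
  mem_SNSet_of_subst (hF.sn (hu _ (hE.var_mem 0)))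

theorem IsCandidate.mem_of_uSteps {E : Set (Tm S)} (hE : IsCandidate E) {t t' : Tm S}
    (ht : t ∈ E) (h : USteps t t') : t' ∈ E := by
  induction h with
  | refl => exact ht
  | tail _ h ih => exact hE.red _ _ ih h

/-! ### Propositions are interpreted by candidates -/

theorem isCandidate_interp (A : Ty) {ρ : ℕ → Set (Tm S)} (hρ : ∀ X, IsCandidate (ρ X)) :
    IsCandidate (interp ρ A) := by
  induction A generalizing ρ with
  | var X => exact hρ X
  | one | top | zero => exact isCandidate_SNSet
  | lolli A B ihA ihB =>
    have hB := ihB hρ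
    convert isCandidate_of_values (S := S)
      (P := fun s => ∀ C u, s = lam C u → ∀ v ∈ interp ρ A, u.inst v ∈ interp ρ B) ?_ ?_ ?_ using 1
    · ext t
      exact and_congr_right fun _ => ⟨fun h s _ hs C u e => h C u (e ▸ hs),
        fun h C u hs => h _ (.lam C u) hs C u rfl⟩
    · rintro _ _ ⟨⟩ hP h C u rfl <;> rcases h with ⟨⟨⟨⟩⟩⟩
      exact fun v hv => hB.red _ _ (hP _ _ rfl v hv) (UStep.subst ‹_› _)
    · rintro _ _ _ hs hs' h C u rfl
      cases h
      exact fun v hv => hB.sum _ _ (hs _ _ rfl v hv) (hs' _ _ rfl v hv)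
    · rintro a _ _ hs h C u rfl
      cases h
      exact fun v hv => hB.prod a _ (hs _ _ rfl v hv)
  | tensor A B ihA ihB =>
    have hA := ihA hρ
    have hB := ihB hρ
    convert isCandidate_of_values (S := S)
      (P := fun s => ∀ u v, s = tensor u v → u ∈ interp ρ A ∧ v ∈ interp ρ B) ?_ ?_ ?_ using 1
    · ext t
      exact and_congr_right fun _ => ⟨fun h s _ hs C u e => h C u (e ▸ hs),
        fun h C u hs => h _ (.tensor C u) hs C u rfl⟩
    · rintro _ _ ⟨⟩ hP h C u rfl <;> rcases h with ⟨⟨⟨⟩⟩⟩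
      · exact ⟨hA.red _ _ (hP _ _ rfl).1 ‹_›, (hP _ _ rfl).2⟩
      · exact ⟨(hP _ _ rfl).1, hB.red _ _ (hP _ _ rfl).2 ‹_›⟩
    · rintro _ _ _ hs hs' h C u rfl
      cases h
    · rintro a _ _ hs h C u rfl
      cases h
  | wth A B ihA ihB =>
    have hA := ihA hρ
    have hB := ihB hρ
    convert isCandidate_of_values (S := S)
      (P := fun s => ∀ u v, s = pair u v → u ∈ interp ρ A ∧ v ∈ interp ρ B) ?_ ?_ ?_ using 1
    · ext t
      exact and_congr_right fun _ => ⟨fun h s _ hs C u e => h C u (e ▸ hs),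
        fun h C u hs => h _ (.pair C u) hs C u rfl⟩
    · rintro _ _ ⟨⟩ hP h C u rfl <;> rcases h with ⟨⟨⟨⟩⟩⟩
      · exact ⟨hA.red _ _ (hP _ _ rfl).1 ‹_›, (hP _ _ rfl).2⟩
      · exact ⟨(hP _ _ rfl).1, hB.red _ _ (hP _ _ rfl).2 ‹_›⟩
    · rintro _ _ _ hs hs' h C u rfl
      cases h
      exact ⟨hA.sum _ _ (hs _ _ rfl).1 (hs' _ _ rfl).1, hB.sum _ _ (hs _ _ rfl).2 (hs' _ _ rfl).2⟩
    · rintro a _ _ hs h C u rfl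
      cases h
      exact ⟨hA.prod a _ (hs _ _ rfl).1, hB.prod a _ (hs _ _ rfl).2⟩
  | plus A B ihA ihB =>
    have hA := ihA hρ
    have hB := ihB hρ
    convert isCandidate_of_values (S := S)
      (P := fun s => (∀ u, s = inl u → u ∈ interp ρ A) ∧ ∀ v, s = inr v → v ∈ interp ρ B)
      ?_ ?_ ?_ using 1
    · ext t
      exact and_congr_right fun _ =>
        ⟨fun h s _ hs => ⟨fun u e => h.1 u (e ▸ hs), fun u e => h.2 u (e ▸ hs)⟩,
        fun h => ⟨fun u hs => (h _ (.inl u) hs).1 u rfl, fun u hs => (h _ (.inr u) hs).2 u rfl⟩⟩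
    · rintro _ _ ⟨⟩ hP h <;> refine ⟨?_, ?_⟩ <;> rintro u rfl <;> rcases h with ⟨⟨⟨⟩⟩⟩
      · exact hA.red _ _ (hP.1 _ rfl) ‹_›
      · exact hB.red _ _ (hP.2 _ rfl) ‹_›
    · rintro _ _ _ hs hs' h
      refine ⟨?_, ?_⟩ <;> rintro u rfl <;> cases h
    · rintro a _ _ hs h
      refine ⟨?_, ?_⟩ <;> rintro u rfl <;> cases h
  | bang A ihA =>
    have hA := ihA hρ
    convert isCandidate_of_values (S := S)
      (P := fun s => ∀ u, s = bang u → u ∈ interp ρ A) ?_ ?_ ?_ using 1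
    · ext t
      exact and_congr_right fun _ => ⟨fun h s _ hs u e => h u (e ▸ hs),
        fun h u hs => h _ (.bang u) hs u rfl⟩
    · rintro _ _ ⟨⟩ hP h u rfl <;> rcases h with ⟨⟨⟨⟩⟩⟩
      exact hA.red _ _ (hP _ rfl) ‹_›
    · rintro _ _ _ hs hs' h u rfl
      cases h
      exact hA.sum _ _ (hs _ rfl) (hs' _ rfl)
    · rintro a _ _ hs h u rfl
      cases h
      exact hA.prod a _ (hs _ rfl)
  | all A ihA =>
    have hA : ∀ E : Set (Tm S), IsCandidate E → IsCandidate (interp (scons E ρ) A) :=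
      fun E hE => ihA fun X => by cases X; exacts [hE, hρ _]
    convert isCandidate_of_values (S := S)
      (P := fun s => ∀ u, s = tlam u → ∀ E : Set (Tm S), IsCandidate E → ∀ B : Ty,
        u.tyInst B ∈ interp (scons E ρ) A) ?_ ?_ ?_ using 1
    · ext t
      exact and_congr_right fun _ => ⟨fun h s _ hs u e => h u (e ▸ hs),
        fun h u hs => h _ (.tlam u) hs u rfl⟩
    · rintro _ _ ⟨⟩ hP h u rfl <;> rcases h with ⟨⟨⟨⟩⟩⟩
      exact fun E hE B => (hA E hE).red _ _ (hP _ rfl E hE B) (UStep.tySubst ‹_› _)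
    · rintro _ _ _ hs hs' h u rfl
      cases h
      exact fun E hE B => (hA E hE).sum _ _ (hs _ rfl E hE B) (hs' _ rfl E hE B)
    · rintro a _ _ hs h u rfl
      cases h
      exact fun E hE B => (hA E hE).prod a _ (hs _ rfl E hE B)

theorem interp_rename (A : Ty) (f : ℕ → ℕ) (ρ : ℕ → Set (Tm S)) :
    interp ρ (A.rename f) = interp (fun n => ρ (f n)) A := by
  induction A generalizing f ρ with
  | all A ih =>
    have : ∀ E : Set (Tm S), (fun n => scons E ρ (Ty.upRen f n)) = scons E fun n => ρ (f n) := by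
      intro E; funext n; cases n <;> rfl
    simp only [Ty.rename, interp, ih, this]
  | _ => simp_all [Ty.rename, interp]

theorem interp_subst (A : Ty) (θ : ℕ → Ty) (ρ : ℕ → Set (Tm S)) :
    interp ρ (A.subst θ) = interp (fun n => interp ρ (θ n)) A := by
  induction A generalizing θ ρ with
  | all A ih =>
    have : ∀ E : Set (Tm S),
        (fun n => interp (scons E ρ) (Ty.up θ n)) = scons E fun n => interp ρ (θ n) := by
      intro E; funext n
      cases n with
      | zero => rfl
      | succ n => exact interp_rename _ _ _
    simp only [Ty.subst, interp, ih, this]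
  | _ => simp_all [Ty.subst, interp]

theorem interp_inst (B A : Ty) (ρ : ℕ → Set (Tm S)) :
    interp ρ (B.inst A) = interp (scons (interp ρ A) ρ) B := by
  rw [Ty.inst, interp_subst]
  congr 1
  funext n
  cases n <;> rfl

end Reduction

end LS2

namespace LS2

section Adequacy

open Tm

variable {S : Type*} [Semiring S] {E F G : Set (Tm S)}

/-! ### Membership of eliminations in a candidate

An elimination is not an introduction, so it lies in a candidate `G` as soon as all its one-step
reducts do; these are handled by induction along the reductions of its immediate sub-terms. -/

theorem elimOne_mem (hG : IsCandidate G) {t u : Tm S} (ht : t ∈ SNSet S) (hu : u ∈ G) :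
    elimOne t u ∈ G := by
  have hsn := hG.sn hu
  induction t, ht using SNSet_induction generalizing u with | step t _ iht
  induction u, hsn using SNSet_induction with | step u hsn ihu
  refine hG.neutral _ (by rintro ⟨⟩) ?_
  rintro _ (⟨⟨⟨⟩⟩⟩ | _)
  · exact hG.prod _ _ hu
  · exact iht _ ‹_› hu hsn
  · exact ihu _ ‹_› (hG.red _ _ hu ‹_›)

theorem elimZero_mem (hG : IsCandidate G) {t : Tm S} (ht : t ∈ SNSet S) : elimZero t ∈ G := by
  induction t, ht using SNSet_induction with | step t _ iht
  refine hG.neutral _ (by rintro ⟨⟩) ?_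
  rintro _ (⟨⟨⟨⟩⟩⟩ | _)
  exact iht _ ‹_›

theorem app_mem (hE : IsCandidate E) (hG : IsCandidate G) {t u : Tm S} (ht : t ∈ SNSet S)
    (htE : ∀ C w, USteps t (lam C w) → ∀ v ∈ E, w.inst v ∈ G) (hu : u ∈ E) : app t u ∈ G := by
  have hsn := hE.sn hu
  induction t, ht using SNSet_induction generalizing u with | step t _ iht
  induction u, hsn using SNSet_induction with | step u hsn ihu
  refine hG.neutral _ (by rintro ⟨⟩) ?_
  rintro _ (⟨⟨⟨⟩⟩⟩ | _)
  · exact htE _ _ .refl u hu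
  · exact iht _ ‹_› (fun C w h => htE C w (.head ‹_› h)) hu hsn
  · exact ihu _ ‹_› (hE.red _ _ hu ‹_›)

theorem tapp_mem (hG : IsCandidate G) {t : Tm S} {A : Ty} (ht : t ∈ SNSet S)
    (htE : ∀ w, USteps t (tlam w) → w.tyInst A ∈ G) : tapp t A ∈ G := by
  induction t, ht using SNSet_induction with | step t _ iht
  refine hG.neutral _ (by rintro ⟨⟩) ?_
  rintro _ (⟨⟨⟨⟩⟩⟩ | _)
  · exact htE _ .refl
  · exact iht _ ‹_› fun w h => htE w (.head ‹_› h)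

theorem elimTensor_mem (hE : IsCandidate E) (hF : IsCandidate F) (hG : IsCandidate G)
    {t u : Tm S} (A B : Ty) (ht : t ∈ SNSet S)
    (htE : ∀ v w, USteps t (tensor v w) → v ∈ E ∧ w ∈ F)
    (hu : ∀ v ∈ E, ∀ w ∈ F, u.inst₂ v w ∈ G) : elimTensor t A B u ∈ G := by
  have hsn : u ∈ SNSet S :=
    mem_SNSet_of_subst (hG.sn (hu _ (hE.var_mem 0) _ (hF.var_mem 0)))
  induction t, ht using SNSet_induction generalizing u with | step t _ iht
  induction u, hsn using SNSet_induction with | step u hsn ihu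
  -- The components of a sum or a scalar product are ultra-reducts of it.
  have red : ∀ t', UStep t t' → elimTensor t' A B u ∈ G := fun t' h' =>
    iht t' h' (fun v w h => htE v w (.head h' h)) hu hsn
  refine hG.neutral _ (by rintro ⟨⟩) ?_
  rintro _ (⟨⟨⟨⟩⟩⟩ | _)
  · exact hu _ (htE _ _ .refl).1 _ (htE _ _ .refl).2
  · exact hG.sum _ _ (red _ (.root (.sumLeft _ _))) (red _ (.root (.sumRight _ _)))
  · exact hG.prod _ _ (red _ (.root (.prod _ _)))
  · exact red _ ‹_›
  · exact ihu _ ‹_› fun v hv w hw => hG.red _ _ (hu v hv w hw) (UStep.subst ‹_› _)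

theorem elimWith1_mem (hE : IsCandidate E) (hG : IsCandidate G) {t u : Tm S} (A : Ty)
    (ht : t ∈ SNSet S) (htE : ∀ v w, USteps t (pair v w) → v ∈ E)
    (hu : ∀ v ∈ E, u.inst v ∈ G) : elimWith1 t A u ∈ G := by
  have hsn : u ∈ SNSet S := hE.mem_SNSet_of_inst hG hu
  induction t, ht using SNSet_induction generalizing u with | step t _ iht
  induction u, hsn using SNSet_induction with | step u hsn ihu
  refine hG.neutral _ (by rintro ⟨⟩) ?_
  rintro _ (⟨⟨⟨⟩⟩⟩ | _)
  · exact hu _ (htE _ _ .refl)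
  · exact iht _ ‹_› (fun v w h => htE v w (.head ‹_› h)) hu hsn
  · exact ihu _ ‹_› fun v hv => hG.red _ _ (hu v hv) (UStep.subst ‹_› _)

theorem elimWith2_mem (hE : IsCandidate E) (hG : IsCandidate G) {t u : Tm S} (B : Ty)
    (ht : t ∈ SNSet S) (htE : ∀ v w, USteps t (pair v w) → w ∈ E)
    (hu : ∀ v ∈ E, u.inst v ∈ G) : elimWith2 t B u ∈ G := by
  have hsn : u ∈ SNSet S := hE.mem_SNSet_of_inst hG hu
  induction t, ht using SNSet_induction generalizing u with | step t _ iht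
  induction u, hsn using SNSet_induction with | step u hsn ihu
  refine hG.neutral _ (by rintro ⟨⟩) ?_
  rintro _ (⟨⟨⟨⟩⟩⟩ | _)
  · exact hu _ (htE _ _ .refl)
  · exact iht _ ‹_› (fun v w h => htE v w (.head ‹_› h)) hu hsn
  · exact ihu _ ‹_› fun v hv => hG.red _ _ (hu v hv) (UStep.subst ‹_› _)

theorem elimPlus_mem (hE : IsCandidate E) (hF : IsCandidate F) (hG : IsCandidate G)
    {t u v : Tm S} (A B : Ty) (ht : t ∈ SNSet S) (htE : ∀ w, USteps t (inl w) → w ∈ E)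
    (htF : ∀ w, USteps t (inr w) → w ∈ F) (hu : ∀ w ∈ E, u.inst w ∈ G)
    (hv : ∀ w ∈ F, v.inst w ∈ G) : elimPlus t A u B v ∈ G := by
  have hsnu : u ∈ SNSet S := hE.mem_SNSet_of_inst hG hu
  have hsnv : v ∈ SNSet S := hF.mem_SNSet_of_inst hG hv
  induction t, ht using SNSet_induction generalizing u v with | step t _ iht
  induction u, hsnu using SNSet_induction generalizing v with | step u hsnu ihu
  induction v, hsnv using SNSet_induction with | step v hsnv ihv
  -- The components of a sum or a scalar product are ultra-reducts of it.
  have red : ∀ t', UStep t t' → elimPlus t' A u B v ∈ G := fun t' h' =>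
    iht t' h' (fun w h => htE w (.head h' h)) (fun w h => htF w (.head h' h)) hu hv hsnu hsnv
  refine hG.neutral _ (by rintro ⟨⟩) ?_
  rintro _ (⟨⟨⟨⟩⟩⟩ | _)
  · exact hu _ (htE _ .refl)
  · exact hv _ (htF _ .refl)
  · exact hG.sum _ _ (red _ (.root (.sumLeft _ _))) (red _ (.root (.sumRight _ _)))
  · exact hG.prod _ _ (red _ (.root (.prod _ _)))
  · exact red _ ‹_›
  · exact ihu _ ‹_› (fun w hw => hG.red _ _ (hu w hw) (UStep.subst ‹_› _)) hv hsnv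
  · exact ihv _ ‹_› fun w hw => hG.red _ _ (hv w hw) (UStep.subst ‹_› _)

theorem elimBang_mem (hE : IsCandidate E) (hG : IsCandidate G) {t u : Tm S} (A : Ty)
    (ht : t ∈ SNSet S) (htE : ∀ v, USteps t (bang v) → v ∈ E)
    (hu : ∀ v ∈ E, u.inst v ∈ G) : elimBang t A u ∈ G := by
  have hsn : u ∈ SNSet S := hE.mem_SNSet_of_inst hG hu
  induction t, ht using SNSet_induction generalizing u with | step t _ iht
  induction u, hsn using SNSet_induction with | step u hsn ihu
  refine hG.neutral _ (by rintro ⟨⟩) ?_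
  rintro _ (⟨⟨⟨⟩⟩⟩ | _)
  · exact hu _ (htE _ .refl)
  · exact iht _ ‹_› (fun v h => htE v (.head ‹_› h)) hu hsn
  · exact ihu _ ‹_› fun v hv => hG.red _ _ (hu v hv) (UStep.subst ‹_› _)

/-! ### Membership of introductions in the interpretations -/

section Intro

variable {ρ : ℕ → Set (Tm S)} {A B : Ty} {t u : Tm S}

theorem lam_mem (hρ : ∀ X, IsCandidate (ρ X)) (C : Ty)
    (h : ∀ v ∈ interp ρ A, t.inst v ∈ interp ρ B) : lam C t ∈ interp ρ (.lolli A B) := by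
  have hB := isCandidate_interp B hρ
  refine ⟨mem_SNSet_of_inv (fun _ _ => UStep.lam_inv)
    ((isCandidate_interp A hρ).mem_SNSet_of_inst hB h), fun C' u hs v hv => ?_⟩
  obtain ⟨t', ht', e⟩ := USteps.of_inv (fun _ _ => UStep.lam_inv) hs
  cases e
  exact hB.mem_of_uSteps (h v hv) (ht'.subst _)

theorem tensor_mem (hρ : ∀ X, IsCandidate (ρ X)) (ht : t ∈ interp ρ A) (hu : u ∈ interp ρ B) :
    tensor t u ∈ interp ρ (.tensor A B) := by
  have hA := isCandidate_interp A hρ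
  have hB := isCandidate_interp B hρ
  refine ⟨mem_SNSet_of_inv₂ (fun _ _ _ => UStep.tensor_inv) (hA.sn ht) (hB.sn hu),
    fun v w hs => ?_⟩
  obtain ⟨t', u', ht', hu', e⟩ := USteps.of_inv₂ (fun _ _ _ => UStep.tensor_inv) hs
  cases e
  exact ⟨hA.mem_of_uSteps ht ht', hB.mem_of_uSteps hu hu'⟩

theorem pair_mem (hρ : ∀ X, IsCandidate (ρ X)) (ht : t ∈ interp ρ A) (hu : u ∈ interp ρ B) :
    pair t u ∈ interp ρ (.wth A B) := by
  have hA := isCandidate_interp A hρ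
  have hB := isCandidate_interp B hρ
  refine ⟨mem_SNSet_of_inv₂ (fun _ _ _ => UStep.pair_inv) (hA.sn ht) (hB.sn hu),
    fun v w hs => ?_⟩
  obtain ⟨t', u', ht', hu', e⟩ := USteps.of_inv₂ (fun _ _ _ => UStep.pair_inv) hs
  cases e
  exact ⟨hA.mem_of_uSteps ht ht', hB.mem_of_uSteps hu hu'⟩

theorem inl_mem (hρ : ∀ X, IsCandidate (ρ X)) (ht : t ∈ interp ρ A) :
    inl t ∈ interp ρ (.plus A B) := by
  have hA := isCandidate_interp A hρ
  refine ⟨mem_SNSet_of_inv (fun _ _ => UStep.inl_inv) (hA.sn ht), fun v hs => ?_, fun v hs => ?_⟩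
    <;> obtain ⟨t', ht', e⟩ := USteps.of_inv (fun _ _ => UStep.inl_inv) hs <;> cases e
  exact hA.mem_of_uSteps ht ht'

theorem inr_mem (hρ : ∀ X, IsCandidate (ρ X)) (ht : t ∈ interp ρ B) :
    inr t ∈ interp ρ (.plus A B) := by
  have hB := isCandidate_interp B hρ
  refine ⟨mem_SNSet_of_inv (fun _ _ => UStep.inr_inv) (hB.sn ht), fun v hs => ?_, fun v hs => ?_⟩
    <;> obtain ⟨t', ht', e⟩ := USteps.of_inv (fun _ _ => UStep.inr_inv) hs <;> cases e
  exact hB.mem_of_uSteps ht ht'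

theorem bang_mem (hρ : ∀ X, IsCandidate (ρ X)) (ht : t ∈ interp ρ A) :
    bang t ∈ interp ρ (.bang A) := by
  have hA := isCandidate_interp A hρ
  refine ⟨mem_SNSet_of_inv (fun _ _ => UStep.bang_inv) (hA.sn ht), fun v hs => ?_⟩
  obtain ⟨t', ht', e⟩ := USteps.of_inv (fun _ _ => UStep.bang_inv) hs
  cases e
  exact hA.mem_of_uSteps ht ht'

theorem isCandidate_scons {E : Set (Tm S)} (hE : IsCandidate E) (hρ : ∀ X, IsCandidate (ρ X)) :
    ∀ X, IsCandidate (scons E ρ X)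
  | 0 => hE
  | X + 1 => hρ X

theorem tlam_mem (hρ : ∀ X, IsCandidate (ρ X))
    (h : ∀ E : Set (Tm S), IsCandidate E → ∀ B, t.tyInst B ∈ interp (scons E ρ) A) :
    tlam t ∈ interp ρ (.all A) := by
  have hA : ∀ E : Set (Tm S), IsCandidate E → IsCandidate (interp (scons E ρ) A) :=
    fun E hE => isCandidate_interp A (isCandidate_scons hE hρ)
  refine ⟨mem_SNSet_of_inv (fun _ _ => UStep.tlam_inv) (mem_SNSet_of_tySubst
    ((hA _ isCandidate_SNSet).sn (h _ isCandidate_SNSet .one))), fun u hs E hE B => ?_⟩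
  obtain ⟨t', ht', e⟩ := USteps.of_inv (fun _ _ => UStep.tlam_inv) hs
  cases e
  exact (hA E hE).mem_of_uSteps (h E hE B) (ht'.tySubst _)

end Intro

/-! ### Adequacy -/

/-- The substitution `σ` realizes the context `Γ`: it maps every variable declared in `Γ` to an
element of the interpretation of its proposition. -/
def Realizes (ρ : ℕ → Set (Tm S)) (σ : ℕ → Tm S) (Γ : Ctx) : Prop :=
  ∀ x B, Γ x = some B → σ x ∈ interp ρ B

namespace Realizes

variable {ρ : ℕ → Set (Tm S)} {σ : ℕ → Tm S} {Γ Γ₁ Γ₂ : Ctx}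

theorem bind {A : Ty} {v : Tm S} (h : Realizes ρ σ Γ) (hv : v ∈ interp ρ A) :
    Realizes ρ (scons v σ) (Γ.bind A)
  | 0, _, e => by cases e; exact hv
  | x + 1, B, e => h x B e

theorem skip (h : Realizes ρ σ Γ) (v : Tm S) : Realizes ρ (scons v σ) Γ.skip
  | 0, _, e => by cases e
  | x + 1, B, e => h x B e

theorem left (h : Realizes ρ σ Γ) (hs : Ctx.Split Γ Γ₁ Γ₂) : Realizes ρ σ Γ₁ := by
  intro x B e
  obtain ⟨h₁, _⟩ | ⟨h₁, _⟩ := hs x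
  · exact h x B (h₁ ▸ e)
  · simp [h₁] at e

theorem right (h : Realizes ρ σ Γ) (hs : Ctx.Split Γ Γ₁ Γ₂) : Realizes ρ σ Γ₂ := by
  intro x B e
  obtain ⟨_, h₂⟩ | ⟨_, h₂⟩ := hs x
  · simp [h₂] at e
  · exact h x B (h₂ ▸ e)

theorem tyShift (h : Realizes ρ σ Γ) (E : Set (Tm S)) : Realizes (scons E ρ) σ Γ.tyShift := by
  intro x B e
  obtain ⟨A, hA, rfl⟩ := Option.map_eq_some_iff.1 e
  rw [interp_rename]
  exact h x A hA

end Realizes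

/-- Adequacy, for an arbitrary substitution `θ` of the proposition variables in the annotations of
the proof-term. The interpretation of `A` is unrelated to `θ`; this independence is what makes the
case of `Λ` go through, where the bound variable is instantiated by a proposition `B` in the
proof-term and by a candidate `E` in the valuation. -/
theorem Typed.adequacy {Ξ Γ : Ctx} {t : Tm S} {A : Ty} (h : Typed Ξ Γ t A)
    {ρ : ℕ → Set (Tm S)} (hρ : ∀ X, IsCandidate (ρ X)) (θ : ℕ → Ty) {σ : ℕ → Tm S}
    (hΞ : Realizes ρ σ Ξ) (hΓ : Realizes ρ σ Γ) : (t.tySubst θ).subst σ ∈ interp ρ A := by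
  have cand (A : Ty) : IsCandidate (interp ρ A) := isCandidate_interp A hρ
  induction h generalizing ρ θ σ with
  | linAx Ξ x A => exact hΓ x A (by simp [Ctx.single])
  | ax Ξ x A h => exact hΞ x A h
  | sum _ _ iht ihu =>
    exact (cand _).sum _ _ (iht hρ θ hΞ hΓ cand) (ihu hρ θ hΞ hΓ cand)
  | prod a _ iht => exact (cand _).prod a _ (iht hρ θ hΞ hΓ cand)
  | oneI Ξ a => exact star_mem_SNSet a
  | oneE hs _ _ iht ihu =>
    exact elimOne_mem (cand _) (iht hρ θ hΞ (hΓ.left hs) cand) (ihu hρ θ hΞ (hΓ.right hs) cand)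
  | lolliI _ iht =>
    refine lam_mem hρ _ fun v hv => ?_
    rw [inst_subst_up]
    exact iht hρ θ (hΞ.skip v) (hΓ.bind hv) cand
  | lolliE hs _ _ iht ihu =>
    obtain ⟨ht, htE⟩ := iht hρ θ hΞ (hΓ.left hs) cand
    exact app_mem (cand _) (cand _) ht htE (ihu hρ θ hΞ (hΓ.right hs) cand)
  | tensorI hs _ _ iht ihu =>
    exact tensor_mem hρ (iht hρ θ hΞ (hΓ.left hs) cand) (ihu hρ θ hΞ (hΓ.right hs) cand)
  | tensorE hs _ _ iht ihu =>
    obtain ⟨ht, htE⟩ := iht hρ θ hΞ (hΓ.left hs) cand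
    refine elimTensor_mem (cand _) (cand _) (cand _) _ _ ht htE fun v hv w hw => ?_
    rw [inst₂_subst_up]
    exact ihu hρ θ ((hΞ.skip v).skip w) (((hΓ.right hs).bind hv).bind hw) cand
  | topI => exact unit_mem_SNSet
  | zeroE C hs _ iht => exact elimZero_mem (cand _) (iht hρ θ hΞ (hΓ.left hs) cand)
  | withI _ _ iht ihu => exact pair_mem hρ (iht hρ θ hΞ hΓ cand) (ihu hρ θ hΞ hΓ cand)
  | withE1 hs _ _ iht ihu =>
    obtain ⟨ht, htE⟩ := iht hρ θ hΞ (hΓ.left hs) cand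
    refine elimWith1_mem (cand _) (cand _) _ ht (fun v w h => (htE v w h).1) fun v hv => ?_
    rw [inst_subst_up]
    exact ihu hρ θ (hΞ.skip v) ((hΓ.right hs).bind hv) cand
  | withE2 hs _ _ iht ihu =>
    obtain ⟨ht, htE⟩ := iht hρ θ hΞ (hΓ.left hs) cand
    refine elimWith2_mem (cand _) (cand _) _ ht (fun v w h => (htE v w h).2) fun v hv => ?_
    rw [inst_subst_up]
    exact ihu hρ θ (hΞ.skip v) ((hΓ.right hs).bind hv) cand
  | plusI1 B _ iht => exact inl_mem hρ (iht hρ θ hΞ hΓ cand)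
  | plusI2 A _ iht => exact inr_mem hρ (iht hρ θ hΞ hΓ cand)
  | plusE hs _ _ _ iht ihu ihv =>
    obtain ⟨ht, htE, htF⟩ := iht hρ θ hΞ (hΓ.left hs) cand
    refine elimPlus_mem (cand _) (cand _) (cand _) _ _ ht htE htF (fun w hw => ?_) fun w hw => ?_
    · rw [inst_subst_up]
      exact ihu hρ θ (hΞ.skip w) ((hΓ.right hs).bind hw) cand
    · rw [inst_subst_up]
      exact ihv hρ θ (hΞ.skip w) ((hΓ.right hs).bind hw) cand
  | bangI _ iht => exact bang_mem hρ (iht hρ θ hΞ hΓ cand)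
  | bangE hs _ _ iht ihu =>
    obtain ⟨ht, htE⟩ := iht hρ θ hΞ (hΓ.left hs) cand
    refine elimBang_mem (cand _) (cand _) _ ht htE fun v hv => ?_
    rw [inst_subst_up]
    exact ihu hρ θ (hΞ.bind hv) ((hΓ.right hs).skip v) cand
  | allI _ iht =>
    refine tlam_mem hρ fun E hE B => ?_
    rw [tyInst_subst, tyInst_tySubst_up]
    have hρ' := isCandidate_scons hE hρ
    exact iht hρ' (scons B θ) (hΞ.tyShift E) (hΓ.tyShift E) fun A => isCandidate_interp A hρ'
  | allE A _ iht =>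
    obtain ⟨ht, htE⟩ := iht hρ θ hΞ hΓ cand
    rw [interp_inst]
    exact tapp_mem (isCandidate_interp _ (isCandidate_scons (cand A) hρ)) ht
      fun w hw => htE w hw _ (cand A) _

theorem Step.uStep {t t' : Tm S} (h : Step t t') : UStep t t' :=
  Compat.mono (fun _ _ => .base) h

end Adequacy

end LS2

theorem mainTheorem2 {S : Type*} [Semiring S] (Ξ Γ : LS2.Ctx) (t : LS2.Tm S) (A : LS2.Ty)
    (h : LS2.Typed Ξ Γ t A) :
    -- Adequacy
    (∀ ρ : ℕ → Set (LS2.Tm S), (∀ X, LS2.IsCandidate (ρ X)) →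
      ∀ σ : ℕ → LS2.Tm S,
        (∀ x B, Ξ x = some B → σ x ∈ LS2.interp ρ B) →
        (∀ x B, Γ x = some B → σ x ∈ LS2.interp ρ B) →
        t.subst σ ∈ LS2.interp ρ A) ∧
    -- strong normalisation for ultra-reduction
    LS2.SN LS2.UStep t ∧
    -- strong normalisation
    LS2.SN LS2.Step t := by
  have adequacy : ∀ ρ : ℕ → Set (LS2.Tm S), (∀ X, LS2.IsCandidate (ρ X)) → ∀ σ : ℕ → LS2.Tm S,
      LS2.Realizes ρ σ Ξ → LS2.Realizes ρ σ Γ → t.subst σ ∈ LS2.interp ρ A := by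
    intro ρ hρ σ hΞ hΓ
    simpa only [LS2.Tm.tySubst_var] using h.adequacy hρ LS2.Ty.var hΞ hΓ
  have sn : t ∈ LS2.SNSet S := by
    have hρ : ∀ _ : ℕ, LS2.IsCandidate (LS2.SNSet S) := fun _ => LS2.isCandidate_SNSet
    -- Variables belong to every candidate, so the identity substitution realizes every context.
    have hvar : ∀ Δ : LS2.Ctx, LS2.Realizes (fun _ => LS2.SNSet S) LS2.Tm.var Δ :=
      fun _ x B _ => (LS2.isCandidate_interp B hρ).var_mem x
    have := (LS2.isCandidate_interp A hρ).sn (adequacy _ hρ LS2.Tm.var (hvar Ξ) (hvar Γ))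
    rwa [LS2.Tm.subst_var] at this
  exact ⟨adequacy, sn, fun ⟨f, h₀, hf⟩ => sn ⟨f, h₀, fun n => (hf n).uStep⟩⟩
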